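/- Let $\mathbb{T}=\mathbb{R}/2\pi\mathbb{Z}$. For $\nu>0$, $\gamma\in\mathbb{R}$, $k_f>0$ and $k_1,k_3\in\mathbb{Z}$ put $\beta=\sqrt{k_1^2+k_3^2}/k_f$ and consider the operators on $L^2(\mathbb{T};\mathbb{C})$ with domain $H^2(\mathbb{T})$ $$\mathcal{H}'_{k_1,k_3}=-\nu k_f^2\partial_y^2+\frac{ik_1}{k_f^2}\frac{\gamma}{\nu}\sin y,\qquad \mathcal{L}'_{k_1,k_3}=-\nu k_f^2\partial_y^2+\frac{ik_1}{k_f^2}\frac{\gamma}{\nu}\sin y\,\bigl(1-(\beta^2-\partial_y^2)^{-1}\bigr)\quad(\beta>0).$$ For $\beta>1$ let $\|f\|_*=\langle f,\,f-(\beta^2-\partial_y^2)^{-1}f\rangle_{L^2}^{1/2}$, which is a norm on $L^2(\mathbb{T})$. Define $$\Psi(\mathcal{H}'_{k_1,k_3})=\inf\bigl\{\|(\mathcal{H}'_{k_1,k_3}-i\lambda)f\|_{L^2}:\ f\in H^2(\mathbb{T}),\ \lambda\in\mathbb{R},\ \|f\|_{L^2}=1\bigr\},$$ $$\Psi(\mathcal{L}'_{k_1,k_3})=\inf\bigl\{\|(\mathcal{L}'_{k_1,k_3}-i\lambda)f\|_{*}:\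 f\in H^2(\mathbb{T}),\ \lambda\in\mathbb{R},\ \|f\|_{*}=1\bigr\}.$$ There is an absolute constant $c>0$, and for every $K>0$ a constant $C>0$ depending only on $K$, such that for all $0<k_f\le K$, $\nu>0$, $\gamma\in\mathbb{R}$ with $|\gamma|\ge C\nu^2$, and all $k_1,k_3\in\mathbb{Z}$: 1. $\Psi(\mathcal{H}'_{k_1,k_3})\ge c\,|k_1\gamma|^{1/2}$; 2. if $\beta^2=(k_1^2+k_3^2)/k_f^2>1$, then $\Psi(\mathcal{L}'_{k_1,k_3})\ge c\,|k_1\gamma|^{1/2}\,(1-\beta^{-2})$. -/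

import Mathlib

open MeasureTheory
open scoped ENNReal

namespace Kolmogorov

noncomputable section

instance factTwoPiPos : Fact (0 < 2 * Real.pi) := ⟨Real.two_pi_pos⟩

/-- The torus `ℝ / 2πℤ`. -/
abbrev Torus : Type := AddCircle (2 * Real.pi)

/-- The complex Hilbert space `L²` of the torus, for the normalised measure `dy / 2π`. -/
abbrev L2 : Type := Lp ℂ 2 (AddCircle.haarAddCircle : Measure Torus)

/-- The `n`-th Fourier coefficient `(1 / 2π) ∫ f(y) exp(-i n y) dy`. -/
def coeff (f : L2) (n : ℤ) : ℂ := fourierCoeff (T := 2 * Real.pi) f n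

theorem coeff_eq_repr (f : L2) (n : ℤ) : coeff f n = fourierBasis.repr f n :=
  (fourierBasis_repr f n).symm

theorem coeff_add (f g : L2) (n : ℤ) : coeff (f + g) n = coeff f n + coeff g n := by
  rw [coeff_eq_repr, coeff_eq_repr, coeff_eq_repr, map_add, lp.coeFn_add, Pi.add_apply]

theorem coeff_sub (f g : L2) (n : ℤ) : coeff (f - g) n = coeff f n - coeff g n := by
  rw [coeff_eq_repr, coeff_eq_repr, coeff_eq_repr, map_sub, lp.coeFn_sub, Pi.sub_apply]

theorem coeff_smul (c : ℂ) (f : L2) (n : ℤ) : coeff (c • f) n = c * coeff f n := by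
  rw [coeff_eq_repr, coeff_eq_repr, map_smul, lp.coeFn_smul, Pi.smul_apply, smul_eq_mul]

theorem coeff_zero (n : ℤ) : coeff 0 n = 0 := by
  rw [coeff_eq_repr, map_zero, lp.coeFn_zero, Pi.zero_apply]

theorem coeff_injective {f g : L2} (h : ∀ n, coeff f n = coeff g n) : f = g := by
  apply fourierBasis.repr.injective
  apply lp.ext
  funext n
  rw [← coeff_eq_repr, ← coeff_eq_repr, h n]

theorem memlp_coeff (f : L2) : Memℓp (fun n => coeff f n) 2 := by
  have h : (fun n => coeff f n) = fourierBasis.repr f := by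
    funext n
    exact coeff_eq_repr f n
  rw [h]
  exact lp.memℓp _

/-- The `L²` function with a given square summable sequence of Fourier coefficients. -/
def ofCoeff (a : ℤ → ℂ) (ha : Memℓp a 2) : L2 := fourierBasis.repr.symm ⟨a, ha⟩

theorem coeff_ofCoeff (a : ℤ → ℂ) (ha : Memℓp a 2) (n : ℤ) : coeff (ofCoeff a ha) n = a n := by
  rw [coeff_eq_repr, ofCoeff, LinearIsometryEquiv.apply_symm_apply]

/-- The maximal domain in `L²` of the Fourier multiplier with symbol `m`. -/
def multiplierDomain (m : ℤ → ℂ) : Submodule ℂ L2 where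
  carrier := {f | Memℓp (fun n => m n * coeff f n) 2}
  add_mem' := by
    intro f g hf hg
    have h : (fun n => m n * coeff (f + g) n)
        = (fun n => m n * coeff f n) + fun n => m n * coeff g n := by
      funext n
      rw [Pi.add_apply, coeff_add, mul_add]
    rw [Set.mem_ofPred_eq, h]
    exact Memℓp.add hf hg
  zero_mem' := by
    have h : (fun n => m n * coeff 0 n) = (0 : ℤ → ℂ) := by
      funext n
      rw [coeff_zero, mul_zero, Pi.zero_apply]
    rw [Set.mem_ofPred_eq, h]
    exact zero_memℓp
  smul_mem' := by
    intro c f hf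
    have h : (fun n => m n * coeff (c • f) n) = c • fun n => m n * coeff f n := by
      funext n
      rw [Pi.smul_apply, coeff_smul, smul_eq_mul]
      ring
    rw [Set.mem_ofPred_eq, h]
    exact Memℓp.const_smul hf c

theorem mem_multiplierDomain {m : ℤ → ℂ} {f : L2} :
    f ∈ multiplierDomain m ↔ Memℓp (fun n => m n * coeff f n) 2 := Iff.rfl

/-- The Fourier multiplier with symbol `m` on its maximal domain: it sends `f` to the `L²` function
with Fourier coefficients `m n * coeff f n`. -/
def multiplierMap (m : ℤ → ℂ) : multiplierDomain m →ₗ[ℂ] L2 where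
  toFun f := ofCoeff (fun n => m n * coeff f n) (mem_multiplierDomain.1 f.2)
  map_add' f g := by
    apply coeff_injective
    intro n
    rw [coeff_add, coeff_ofCoeff, coeff_ofCoeff, coeff_ofCoeff, Submodule.coe_add, coeff_add,
      mul_add]
  map_smul' c f := by
    apply coeff_injective
    intro n
    rw [RingHom.id_apply, coeff_smul, coeff_ofCoeff, coeff_ofCoeff, Submodule.coe_smul, coeff_smul]
    ring

theorem coeff_multiplierMap (m : ℤ → ℂ) (f : multiplierDomain m) (n : ℤ) :
    coeff (multiplierMap m f) n = m n * coeff f n :=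
  coeff_ofCoeff _ (mem_multiplierDomain.1 f.2) n

/-- The Sobolev space `H²` of the torus: the `f` in `L²` for which the sequence
`(i n)² * coeff f n` is square summable. -/
def H2 : Submodule ℂ L2 := multiplierDomain fun n => (Complex.I * n) ^ 2

/-- The second derivative `∂_y² : H² → L²`. -/
def secondDeriv : H2 →ₗ[ℂ] L2 := multiplierMap fun n => (Complex.I * n) ^ 2

theorem coeff_secondDeriv (f : H2) (n : ℤ) :
    coeff (secondDeriv f) n = (Complex.I * n) ^ 2 * coeff f n :=
  coeff_multiplierMap _ f n

theorem resolvent_domain (β : ℝ) (f : L2) :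
    f ∈ multiplierDomain fun n => ((β : ℂ) ^ 2 + (n : ℂ) ^ 2)⁻¹ := by
  rw [mem_multiplierDomain]
  have hf := (memlp_coeff f).summable (by norm_num)
  have hC := hf.mul_left ((((β ^ 2)⁻¹ + 1 : ℝ)) ^ (2 : ℝ≥0∞).toReal)
  refine memℓp_gen (hC.of_nonneg_of_le (fun n => by positivity) fun n => ?_)
  rw [norm_mul, Real.mul_rpow (norm_nonneg _) (norm_nonneg _)]
  refine mul_le_mul_of_nonneg_right ?_ (by positivity)
  refine Real.rpow_le_rpow (norm_nonneg _) ?_ (by norm_num)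
  have e1 : ((β : ℂ) ^ 2 + (n : ℂ) ^ 2)⁻¹ = (((β ^ 2 + (n : ℝ) ^ 2)⁻¹ : ℝ) : ℂ) := by
    push_cast; ring
  rw [e1, Complex.norm_real, Real.norm_of_nonneg (by positivity)]
  by_cases hn : n = 0
  · subst hn; simp
  · have h1 : (1 : ℝ) ≤ (n : ℝ) ^ 2 := by
      have : (0 : ℤ) < n ^ 2 := by positivity
      have : (1 : ℤ) ≤ n ^ 2 := by linarith
      exact_mod_cast this
    have h2 : (β ^ 2 + (n : ℝ) ^ 2)⁻¹ ≤ 1 := inv_le_one_of_one_le₀ (by nlinarith [sq_nonneg β])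
    have h3 : 0 ≤ (β ^ 2)⁻¹ := by positivity
    linarith

/-- The operator `(β² - ∂_y²)⁻¹` on `L²`, i.e. the Fourier multiplier `1 / (β² + n²)`. -/
def resolvent (β : ℝ) : L2 →ₗ[ℂ] L2 :=
  multiplierMap (fun n => ((β : ℂ) ^ 2 + (n : ℂ) ^ 2)⁻¹) ∘ₗ
    LinearMap.codRestrict _ LinearMap.id (resolvent_domain β)

theorem coeff_resolvent (β : ℝ) (f : L2) (n : ℤ) :
    coeff (resolvent β f) n = ((β : ℂ) ^ 2 + (n : ℂ) ^ 2)⁻¹ * coeff f n :=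
  coeff_multiplierMap _ ⟨f, resolvent_domain β f⟩ n

/-- `resolvent β` takes values in `H²` and is a right inverse of `β² - ∂_y²`. -/
theorem resolvent_right_inverse {β : ℝ} (hβ : β ≠ 0) (f : L2) :
    ∃ h : resolvent β f ∈ H2,
      ((β : ℂ) ^ 2) • resolvent β f - secondDeriv ⟨resolvent β f, h⟩ = f := by
  have key : ∀ n : ℤ, ((β : ℂ) ^ 2 + (n : ℂ) ^ 2) ≠ 0 := by
    intro n
    have : (0 : ℝ) < β ^ 2 + (n : ℝ) ^ 2 := by positivity
    exact_mod_cast this.ne'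
  have e : ∀ n : ℤ, (Complex.I * n) ^ 2 * coeff (resolvent β f) n
      = (β : ℂ) ^ 2 * coeff (resolvent β f) n - coeff f n := by
    intro n
    rw [coeff_resolvent, mul_pow, Complex.I_sq]
    field_simp [key n]
    ring
  have h : resolvent β f ∈ H2 := by
    have h1 : (fun n : ℤ => (Complex.I * n) ^ 2 * coeff (resolvent β f) n)
        = fun n => coeff (((β : ℂ) ^ 2) • resolvent β f - f) n := by
      funext n
      rw [e n, coeff_sub, coeff_smul]
    change Memℓp (fun n : ℤ => (Complex.I * n) ^ 2 * coeff (resolvent β f) n) 2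
    rw [h1]
    exact memlp_coeff _
  refine ⟨h, coeff_injective fun n => ?_⟩
  rw [coeff_sub, coeff_smul, coeff_secondDeriv, e n]
  ring

/-- The function `sin` on the torus. -/
def sinTorus : Torus → ℝ := Real.sin_periodic.lift

theorem continuous_sinTorus : Continuous sinTorus :=
  continuous_quot_lift _ Real.continuous_sin

theorem memLp_sin_mul (f : L2) :
    MemLp (fun y => (sinTorus y : ℂ) * f y) 2 (AddCircle.haarAddCircle : Measure Torus) := by
  refine (Lp.memLp f).of_le ?_ ?_
  · exact ((Complex.continuous_ofReal.comp continuous_sinTorus).aestronglyMeasurable).mul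
      (Lp.aestronglyMeasurable f)
  · refine Filter.Eventually.of_forall fun y => ?_
    rw [norm_mul, Complex.norm_real]
    refine mul_le_of_le_one_left (norm_nonneg _) ?_
    induction y using QuotientAddGroup.induction_on with
    | H x => exact Real.abs_sin_le_one x

/-- Multiplication by `sin y` on `L²`. -/
def sinMul : L2 →ₗ[ℂ] L2 where
  toFun f := (memLp_sin_mul f).toLp _
  map_add' f g := by
    rw [← MemLp.toLp_add]
    refine MemLp.toLp_congr _ _ ?_
    filter_upwards [Lp.coeFn_add f g] with y hy
    rw [hy, Pi.add_apply, Pi.add_apply, mul_add]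
  map_smul' c f := by
    rw [RingHom.id_apply, ← MemLp.toLp_const_smul]
    refine MemLp.toLp_congr _ _ ?_
    filter_upwards [Lp.coeFn_smul c f] with y hy
    rw [hy, Pi.smul_apply, Pi.smul_apply, smul_eq_mul, smul_eq_mul]
    ring

/-- The parameter `β > 0` with `β² = (k₁² + k₃²) / k_f²`. -/
def beta (kf : ℝ) (k₁ k₃ : ℤ) : ℝ := √((k₁ : ℝ) ^ 2 + (k₃ : ℝ) ^ 2) / kf

/-- The local operator `-ν k_f² ∂_y² + (i k₁ / k_f²) (γ / ν) sin y` with domain `H²`.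
It does not depend on `k₃`. -/
def opH (ν γ kf : ℝ) (k₁ _k₃ : ℤ) : L2 →ₗ.[ℂ] L2 where
  domain := H2
  toFun := (-((ν : ℂ) * (kf : ℂ) ^ 2)) • secondDeriv
    + (Complex.I * (k₁ : ℂ) / (kf : ℂ) ^ 2 * ((γ : ℂ) / (ν : ℂ))) • (sinMul ∘ₗ H2.subtype)

/-- The nonlocal operator
`-ν k_f² ∂_y² + (i k₁ / k_f²) (γ / ν) sin y (1 - (β² - ∂_y²)⁻¹)` with domain `H²`. -/
def opL (ν γ kf : ℝ) (k₁ k₃ : ℤ) : L2 →ₗ.[ℂ] L2 where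
  domain := H2
  toFun := (-((ν : ℂ) * (kf : ℂ) ^ 2)) • secondDeriv
    + (Complex.I * (k₁ : ℂ) / (kf : ℂ) ^ 2 * ((γ : ℂ) / (ν : ℂ))) •
      (sinMul ∘ₗ (LinearMap.id - resolvent (beta kf k₁ k₃)) ∘ₗ H2.subtype)

/-- The weighted norm `‖f‖_* = ⟨f, f - (β² - ∂_y²)⁻¹ f⟩^{1/2}`. -/
def starNorm (β : ℝ) (f : L2) : ℝ := √(RCLike.re (inner ℂ f (f - resolvent β f)))

/-- The pseudospectral bound `Ψ(A) = inf {N((A - iμ) f) ; f ∈ D(A), μ ∈ ℝ, N(f) = 1}` of an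
unbounded operator `A` in `L²`, measured in the norm `N`. -/
def Psi (N : L2 → ℝ) (A : L2 →ₗ.[ℂ] L2) : ℝ :=
  sInf {r : ℝ | ∃ (f : A.domain) (μ : ℝ), N (f : L2) = 1 ∧
    r = N (A f - (Complex.I * (μ : ℂ)) • (f : L2))}

end

end Kolmogorov

/-! ### Abstract shear systems -/

namespace Kolmogorov

open scoped InnerProductSpace

/-! Dividing by ν k_f² turns both operators, shifted by a spectral parameter, into -∂² + iα(sin·A -
l) with α = k₁γ/(k_f⁴ν²), where A = 1 or A = 1 - (β² - ∂²)⁻¹, measured in ‖f‖_* = ⟨f, Af⟩^{1/2}. For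
k₁ ≠ 0 the condition on γ gives |α| ≥ 1. With δ = 1, respectively δ = 1 - β⁻², a lower bound for the
symbol of A, it suffices that G = ‖(-∂² + iα(sin·A - l))f‖_* cannot be at most 10⁻¹⁶ δ√|α| when
‖f‖_* = 1.

Put u = Af, e = sin·u - lf, φ = f - Af. Since sin·A is symmetric for ⟨·, A·⟩, the term iα(sin·A - l)
drops out when tested against f or against polynomials in sin·A applied to f. Testing against f
gives ‖Af'‖² ≤ G; testing against ie leaves only a commutator and gives |α|‖e‖_*² ≤ G‖e‖_* +
‖Af'‖‖cos·u‖. So e is small, and it remains to see that a small e and a moderate f' force u to be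
small.

Translation by half a period reduces to l ≥ 0. If l ≥ 1, smallness of ⟨e, u⟩ controls the form of 1
- sin at u, hence ‖cos·u‖, and Hardy's inequality bounds u. If 0 ≤ l < 1, e is tested against the
virial multiplier -2(cos·u)' - u (`low_add_stream_eq`). The nonlocal part has a good sign because φ
solves (b - ∂²)φ = u with b = β² - 1 ≥ 0 (`high_stream_le`), so both u and φ are controlled by B =
2‖e‖‖cos·Af'‖ + 3‖e‖‖u‖. For l ≤ 1/2 this bounds u directly. For 1/2 ≤ l < 1 the factor ‖cos·Af'‖
needs a refined estimate, from testing against f - (sin·A)²f (`norm_c_A_der_sq_le`), in which 1 - l²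
is itself bounded by B and ‖e‖_* (`one_sub_sq_mul_star_sq_le`). -/

/-- Multiplication operators `s`, `c` (sine and cosine), a Fourier multiplier `A`, the complex
structure `J`, the zeroth Fourier mode `z` and the graph `Der` of the derivative, on a real inner
product space, with the algebraic relations that hold between them. -/
structure ShearSystem (E : Type*) [NormedAddCommGroup E] [InnerProductSpace ℝ E] where
  s : E →ₗ[ℝ] E
  c : E →ₗ[ℝ] E
  A : E →ₗ[ℝ] E
  J : E →ₗ[ℝ] E
  z : E →ₗ[ℝ] ℂ
  δ : ℝ
  Der : E → E → Prop
  s_symm : ∀ x y, ⟪s x, y⟫_ℝ = ⟪x, s y⟫_ℝ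
  c_symm : ∀ x y, ⟪c x, y⟫_ℝ = ⟪x, c y⟫_ℝ
  A_symm : ∀ x y, ⟪A x, y⟫_ℝ = ⟪x, A y⟫_ℝ
  J_skew : ∀ x y, ⟪J x, y⟫_ℝ = -⟪x, J y⟫_ℝ
  J_sq : ∀ x, J (J x) = -x
  s_c : ∀ x, s (c x) = c (s x)
  sq_add_sq : ∀ x, s (s x) + c (c x) = x
  J_s : ∀ x, J (s x) = s (J x)
  J_A : ∀ x, J (A x) = A (J x)
  der_sub : ∀ {x x' y y'}, Der x x' → Der y y' → Der (x - y) (x' - y')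
  der_smul : ∀ (r : ℝ) {x x'}, Der x x' → Der (r • x) (r • x')
  der_J : ∀ {x x'}, Der x x' → Der (J x) (J x')
  der_s : ∀ {x x'}, Der x x' → Der (s x) (s x' + c x)
  der_c : ∀ {x x'}, Der x x' → Der (c x) (c x' - s x)
  der_A : ∀ {x x'}, Der x x' → Der (A x) (A x')
  ibp : ∀ {x x' y y'}, Der x x' → Der y y' → ⟪x', y⟫_ℝ = -⟪x, y'⟫_ℝ
  z_der : ∀ {x x'}, Der x x' → z x' = 0
  z_J : ∀ x, ‖z (J x)‖ = ‖z x‖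
  δ_pos : 0 < δ
  δ_le : ∀ x, δ * ⟪x, A x⟫_ℝ ≤ ‖A x‖ ^ 2
  norm_A_sq_le : ∀ x, ‖A x‖ ^ 2 ≤ ⟪x, A x⟫_ℝ
  A_le : ∀ x, ⟪x, A x⟫_ℝ ≤ ‖x‖ ^ 2
  -- Only the zero mode of A may degenerate, as β tends to 1; the other modes have symbol at least
  -- 1/2.
  norm_sq_le : ∀ x, ‖x‖ ^ 2 ≤ 2 * ⟪x, A x⟫_ℝ + ‖z x‖ ^ 2
  z_le : ∀ x, δ * ‖z x‖ ^ 2 ≤ ⟪x, A x⟫_ℝ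
  -- The local case A = 1, or the elliptic equation (b - ∂²)φ = Af for φ = f - Af.
  stream : (∀ x, A x = x) ∨ ∃ b : ℝ, 0 ≤ b ∧ ∀ {x x' x''}, Der x x' → Der x' x'' →
    A x = b • (x - A x) - (x'' - A x'')

namespace ShearSystem

variable {E : Type*} [NormedAddCommGroup E] [InnerProductSpace ℝ E] (M : ShearSystem E)

/-- The system obtained by translating by half a period: `s` and `c` change sign. -/
def neg : ShearSystem E where
  s := -M.s
  c := -M.c
  A := M.A
  J := M.J
  z := M.z
  δ := M.δ
  Der := M.Der
  s_symm x y := by simp [M.s_symm]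
  c_symm x y := by simp [M.c_symm]
  A_symm := M.A_symm
  J_skew := M.J_skew
  J_sq := M.J_sq
  s_c x := by simp [M.s_c]
  sq_add_sq x := by simp [M.sq_add_sq]
  J_s x := by simp [M.J_s]
  J_A := M.J_A
  der_sub := M.der_sub
  der_smul := M.der_smul
  der_J := M.der_J
  der_s {x x'} h := by
    have h2 := M.der_smul (-1) (M.der_s h)
    have e1 : (-M.s) x = (-1 : ℝ) • M.s x := by simp
    have e2 : (-M.s) x' + (-M.c) x = (-1 : ℝ) • (M.s x' + M.c x) := by
      simp only [LinearMap.neg_apply]; module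
    rw [e1, e2]; exact h2
  der_c {x x'} h := by
    have h2 := M.der_smul (-1) (M.der_c h)
    have e1 : (-M.c) x = (-1 : ℝ) • M.c x := by simp
    have e2 : (-M.c) x' - (-M.s) x = (-1 : ℝ) • (M.c x' - M.s x) := by
      simp only [LinearMap.neg_apply]; module
    rw [e1, e2]; exact h2
  der_A := M.der_A
  ibp := M.ibp
  z_der := M.z_der
  z_J := M.z_J
  δ_pos := M.δ_pos
  δ_le := M.δ_le
  norm_A_sq_le := M.norm_A_sq_le
  A_le := M.A_le
  norm_sq_le := M.norm_sq_le
  z_le := M.z_le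
  stream := M.stream

/-! ### Elementary bounds and the star norm -/

theorem norm_s_sq_add_norm_c_sq (x : E) : ‖M.s x‖ ^ 2 + ‖M.c x‖ ^ 2 = ‖x‖ ^ 2 := by
  rw [← real_inner_self_eq_norm_sq, ← real_inner_self_eq_norm_sq, ← real_inner_self_eq_norm_sq,
    M.s_symm, M.c_symm, ← inner_add_right, M.sq_add_sq]

theorem norm_s_le (x : E) : ‖M.s x‖ ≤ ‖x‖ := by
  have := M.norm_s_sq_add_norm_c_sq x
  exact abs_le_of_sq_le_sq' (by nlinarith [sq_nonneg ‖M.c x‖]) (norm_nonneg _) |>.2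

theorem norm_c_le (x : E) : ‖M.c x‖ ≤ ‖x‖ := by
  have := M.norm_s_sq_add_norm_c_sq x
  exact abs_le_of_sq_le_sq' (by nlinarith [sq_nonneg ‖M.s x‖]) (norm_nonneg _) |>.2

theorem norm_J (x : E) : ‖M.J x‖ = ‖x‖ := by
  have : ‖M.J x‖ ^ 2 = ‖x‖ ^ 2 := by
    rw [← real_inner_self_eq_norm_sq, ← real_inner_self_eq_norm_sq, M.J_skew, M.J_sq]; simp
  exact (sq_eq_sq₀ (norm_nonneg _) (norm_nonneg _)).1 this

theorem inner_J_A_self (x : E) : ⟪M.J x, M.A x⟫_ℝ = 0 := by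
  have h1 := M.J_skew x (M.A x)
  have h2 := real_inner_comm (M.J x) (M.A x)
  rw [M.J_A, ← M.A_symm x] at h1
  linarith

theorem inner_J_s_self (x : E) : ⟪M.J x, M.s x⟫_ℝ = 0 := by
  have h1 := M.J_skew x (M.s x)
  have h2 := real_inner_comm (M.J x) (M.s x)
  rw [M.J_s, ← M.s_symm x] at h1
  linarith

theorem A_nonneg (x : E) : 0 ≤ ⟪x, M.A x⟫_ℝ := (sq_nonneg _).trans (M.norm_A_sq_le x)

/-- The norm `⟪x, A x⟫^{1/2}`. -/
noncomputable def star (x : E) : ℝ := √⟪x, M.A x⟫_ℝ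

theorem star_nonneg (x : E) : 0 ≤ M.star x := Real.sqrt_nonneg _

theorem star_sq (x : E) : M.star x ^ 2 = ⟪x, M.A x⟫_ℝ := Real.sq_sqrt (M.A_nonneg x)

theorem star_le_norm (x : E) : M.star x ≤ ‖x‖ :=
  Real.sqrt_le_iff.2 ⟨norm_nonneg _, M.A_le x⟩

theorem norm_A_le_star (x : E) : ‖M.A x‖ ≤ M.star x :=
  Real.le_sqrt_of_sq_le (M.norm_A_sq_le x)

theorem star_J (x : E) : M.star (M.J x) = M.star x := by
  rw [star, star, ← M.J_A, M.J_skew, M.J_sq, inner_neg_right, neg_neg]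

/-- Cauchy–Schwarz for the nonnegative form ⟨·, A·⟩, via its discriminant. -/
theorem abs_inner_A_le (x y : E) : |⟪x, M.A y⟫_ℝ| ≤ M.star x * M.star y := by
  have key : ∀ t : ℝ, 0 ≤ ⟪y, M.A y⟫_ℝ * (t * t) + (2 * ⟪x, M.A y⟫_ℝ) * t + ⟪x, M.A x⟫_ℝ := by
    intro t
    have h := M.A_nonneg (x + t • y)
    have e : ⟪y, M.A x⟫_ℝ = ⟪x, M.A y⟫_ℝ := by rw [← M.A_symm, real_inner_comm]
    simp only [map_add, map_smul, inner_add_left, inner_add_right, real_inner_smul_left,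
      real_inner_smul_right, e] at h
    linarith
  have h := discrim_le_zero key
  rw [discrim] at h
  apply abs_le_of_sq_le_sq _ (mul_nonneg (M.star_nonneg _) (M.star_nonneg _))
  rw [mul_pow, M.star_sq, M.star_sq]
  nlinarith

theorem inner_A_le (x y : E) : ⟪x, M.A y⟫_ℝ ≤ M.star x * M.star y :=
  (le_abs_self _).trans (M.abs_inner_A_le x y)

theorem star_s_A_le (x : E) : M.star (M.s (M.A x)) ≤ M.star x :=
  (M.star_le_norm _).trans ((M.norm_s_le _).trans (M.norm_A_le_star x))

/-! ### The weights 1 ± s, Hardy's inequality and the stream function -/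

/-- The quadratic form of `1 - s`. -/
def low (x : E) : ℝ := ‖x‖ ^ 2 - ⟪M.s x, x⟫_ℝ

/-- The quadratic form of `1 + s`. -/
def high (x : E) : ℝ := ‖x‖ ^ 2 + ⟪M.s x, x⟫_ℝ

theorem two_mul_low (x : E) : 2 * M.low x = ‖x - M.s x‖ ^ 2 + ‖M.c x‖ ^ 2 := by
  rw [low, norm_sub_sq_real, real_inner_comm]
  linarith [M.norm_s_sq_add_norm_c_sq x]

theorem two_mul_high (x : E) : 2 * M.high x = ‖x + M.s x‖ ^ 2 + ‖M.c x‖ ^ 2 := by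
  rw [high, norm_add_sq_real, real_inner_comm]
  linarith [M.norm_s_sq_add_norm_c_sq x]

theorem low_nonneg (x : E) : 0 ≤ M.low x := by
  linarith [M.two_mul_low x, sq_nonneg ‖x - M.s x‖, sq_nonneg ‖M.c x‖]

theorem high_nonneg (x : E) : 0 ≤ M.high x := by
  linarith [M.two_mul_high x, sq_nonneg ‖x + M.s x‖, sq_nonneg ‖M.c x‖]

theorem low_le (x : E) : M.low x ≤ 2 * ‖x‖ ^ 2 := by
  have h1 := M.high_nonneg x
  have h2 : M.low x + M.high x = 2 * ‖x‖ ^ 2 := by rw [low, high]; ring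
  linarith

theorem low_sub_le (x y : E) : M.low (x - y) ≤ 2 * M.low x + 2 * M.low y := by
  have h : M.low (x - y) + M.low (x + y) = 2 * M.low x + 2 * M.low y := by
    simp only [low, norm_sub_sq_real, norm_add_sq_real, map_add, map_sub, inner_add_left,
      inner_add_right, inner_sub_left, inner_sub_right]
    ring
  linarith [M.low_nonneg (x + y)]

theorem low_smul (r : ℝ) (x : E) : M.low (r • x) = r ^ 2 * M.low x := by
  simp only [low, norm_smul, map_smul, real_inner_smul_left, real_inner_smul_right, mul_pow,
    Real.norm_eq_abs, sq_abs]
  ring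

theorem low_s_le (x : E) : M.low (M.s x) ≤ M.low x := by
  have h1 := M.two_mul_low x
  have h2 := M.two_mul_low (M.s x)
  rw [← map_sub, ← M.s_c] at h2
  have h3 := M.norm_s_le (x - M.s x)
  have h4 := M.norm_s_le (M.c x)
  have h5 := pow_le_pow_left₀ (norm_nonneg _) h3 2
  have h6 := pow_le_pow_left₀ (norm_nonneg _) h4 2
  linarith

/-- The arithmetic-geometric mean inequality with c² = (1 + s)(1 - s), written as a sum of two
squares. -/
theorem two_mul_inner_c_le (x y : E) : 2 * ⟪M.c x, y⟫_ℝ ≤ M.high x + M.low y := by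
  have h : 2 * (M.high x - 2 * ⟪M.c x, y⟫_ℝ + M.low y)
      = ‖(x + M.s x) - M.c y‖ ^ 2 + ‖(y - M.s y) - M.c x‖ ^ 2 := by
    rw [norm_sub_sq_real, norm_sub_sq_real]
    have e1 := M.two_mul_high x
    have e2 := M.two_mul_low y
    have e3 : ⟪M.s x, M.c y⟫_ℝ = ⟪M.s y, M.c x⟫_ℝ := by
      rw [M.s_symm, M.s_c, ← M.c_symm, real_inner_comm]
    have e4 : ⟪x, M.c y⟫_ℝ = ⟪M.c x, y⟫_ℝ := (M.c_symm x y).symm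
    have e5 : ⟪y, M.c x⟫_ℝ = ⟪M.c x, y⟫_ℝ := real_inner_comm _ _
    rw [inner_add_left, inner_sub_left, e3, e4, e5]
    linarith
  linarith [sq_nonneg ‖(x + M.s x) - M.c y‖, sq_nonneg ‖(y - M.s y) - M.c x‖]

theorem norm_c_sq_le (x : E) : ‖M.c x‖ ^ 2 ≤ 2 * M.low x := by
  linarith [M.two_mul_low x, sq_nonneg ‖x - M.s x‖]

theorem norm_sub_s_sq_le (x : E) : ‖x - M.s x‖ ^ 2 ≤ 2 * M.low x := by
  linarith [M.two_mul_low x, sq_nonneg ‖M.c x‖]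

theorem two_mul_inner_c_der {x x' : E} (h : M.Der x x') :
    2 * ⟪M.c x', x⟫_ℝ = ⟪M.s x, x⟫_ℝ := by
  have h1 := M.ibp h (M.der_c h)
  have h2 := real_inner_comm x (M.c x')
  rw [inner_sub_right, ← M.c_symm x', ← M.s_symm x] at h1
  linarith

/-- Hardy's inequality at the zeros of the cosine. -/
theorem norm_sq_le_norm_c {x x' : E} (h : M.Der x x') :
    ‖x‖ ^ 2 ≤ 2 * ‖M.c x‖ ^ 2 + 2 * (‖M.c x‖ * ‖x'‖) := by
  -- Integrating ⟨(s x)', c x⟩ by parts expresses ‖s x‖² - ‖c x‖² through ⟨x', s c x⟩; adding 2‖c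
  -- x‖² recovers ‖x‖².
  have h1 := M.ibp (M.der_s h) (M.der_c h)
  rw [inner_add_left, inner_sub_right, M.s_symm x', ← M.c_symm (M.s x), ← M.s_c,
    real_inner_self_eq_norm_sq, real_inner_self_eq_norm_sq,
    real_inner_comm x' (M.s (M.c x))] at h1
  have h2 : ⟪x', M.s (M.c x)⟫_ℝ ≤ ‖M.c x‖ * ‖x'‖ := by
    refine (real_inner_le_norm _ _).trans ?_
    rw [mul_comm]
    exact mul_le_mul_of_nonneg_right (M.norm_s_le _) (norm_nonneg _)
  linarith [M.norm_s_sq_add_norm_c_sq x, real_inner_comm x' (M.s (M.c x))]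

/-- With φ = f - Af and Af = bφ - φ'', integration by parts turns the right side into `b * low φ +
high φ'`; the first term is dropped since b ≥ 0. For A = 1, φ vanishes. -/
theorem high_stream_le {f f' f'' : E} (h : M.Der f f') (h' : M.Der f' f'') :
    M.high (f' - M.A f') ≤ ⟪f - M.A f, M.A f⟫_ℝ - 2 * ⟪M.c (f' - M.A f'), M.A f⟫_ℝ := by
  rcases M.stream with hA | ⟨b, hb, hA⟩
  · simp [hA, high]
  · have hu := hA h h'
    have d1 := M.der_sub h (M.der_A h)
    have d2 := M.der_sub h' (M.der_A h')
    set φ := f - M.A f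
    set φ' := f' - M.A f'
    set φ'' := f'' - M.A f''
    have e1 := M.ibp d1 d2
    have e2 := M.two_mul_inner_c_der d1
    have e3 := M.two_mul_inner_c_der d2
    have e4 : ⟪M.c φ', φ''⟫_ℝ = ⟪M.c φ'', φ'⟫_ℝ := by
      rw [M.c_symm, real_inner_comm]
    have e5 := M.low_nonneg φ
    rw [low] at e5
    rw [hu]
    simp only [inner_sub_right, real_inner_smul_right, high]
    rw [real_inner_self_eq_norm_sq] at *
    rw [e4]
    nlinarith

/-! ### Testing the operator: energy, defect and smoothing -/

/-- `(s A - l) f`. -/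
def defect (l : ℝ) (f : E) : E := M.s (M.A f) - l • f

/-- `-f'' + i α (s A - l) f`, as a function of `f` and its second derivative. -/
def op (α l : ℝ) (f f'' : E) : E := -f'' + α • M.J (M.defect l f)

theorem der_defect (l : ℝ) {f f' : E} (h : M.Der f f') :
    M.Der (M.defect l f) (M.s (M.A f') + M.c (M.A f) - l • f') :=
  M.der_sub (M.der_s (M.der_A h)) (M.der_smul l h)

variable {f f' f'' : E} (α l : ℝ)

theorem inner_J_s_A (x : E) : ⟪M.J (M.s (M.A x)), M.A x⟫_ℝ = 0 := by
  rw [M.J_s, M.s_symm]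
  exact M.inner_J_s_self _

theorem inner_J_defect (x : E) : ⟪M.J (M.defect l x), M.A x⟫_ℝ = 0 := by
  rw [defect, map_sub, map_smul, inner_sub_left, real_inner_smul_left, inner_J_s_A,
    inner_J_A_self]
  simp

theorem inner_der_A_der (h : M.Der f f') (h' : M.Der f' f'') :
    ⟪f', M.A f'⟫_ℝ = ⟪M.op α l f f'', M.A f⟫_ℝ := by
  have h1 := M.ibp h' (M.der_A h)
  rw [op, inner_add_left, inner_neg_left, real_inner_smul_left, inner_J_defect, h1]
  simp

theorem norm_A_der_sq_le (h : M.Der f f') (h' : M.Der f' f'') :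
    ‖M.A f'‖ ^ 2 ≤ M.star (M.op α l f f'') * M.star f :=
  (M.norm_A_sq_le f').trans ((M.inner_der_A_der α l h h').le.trans (M.inner_A_le _ _))

/-- Tests the operator against A J e, e the defect. In the derivative of e the part (s A - l) f'
pairs to zero with f' by skewness, so only the commutator c A f survives. -/
theorem abs_mul_star_defect_sq_le (h : M.Der f f') (h' : M.Der f' f'') :
    |α| * M.star (M.defect l f) ^ 2 ≤
      M.star (M.op α l f f'') * M.star (M.defect l f) + ‖M.A f'‖ * ‖M.c (M.A f)‖ := by
  have he := M.der_A (M.der_J (M.der_defect l h))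
  have h1 := M.ibp h' he
  have h2 : ⟪f', M.A (M.J (M.s (M.A f') + M.c (M.A f) - l • f'))⟫_ℝ
      = ⟪M.A f', M.J (M.c (M.A f))⟫_ℝ := by
    rw [← M.A_symm, map_sub, map_add, map_smul, inner_sub_right, inner_add_right,
      real_inner_smul_right]
    have e1 := M.inner_J_s_A f'
    have e2 := M.inner_J_A_self f'
    rw [real_inner_comm] at e1 e2
    rw [e1, e2]
    ring
  have h3 : α * M.star (M.defect l f) ^ 2
      = ⟪M.op α l f f'', M.A (M.J (M.defect l f))⟫_ℝ - ⟪M.A f', M.J (M.c (M.A f))⟫_ℝ := by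
    rw [← M.star_J, M.star_sq, op, inner_add_left, inner_neg_left, real_inner_smul_left, h1, h2]
    ring
  have h4 := M.abs_inner_A_le (M.op α l f f'') (M.J (M.defect l f))
  have h5 := abs_real_inner_le_norm (M.A f') (M.J (M.c (M.A f)))
  rw [M.norm_J] at h5
  rw [M.star_J] at h4
  calc |α| * M.star (M.defect l f) ^ 2 = |α * M.star (M.defect l f) ^ 2| := by
        rw [abs_mul, abs_of_nonneg (sq_nonneg (M.star _))]
    _ ≤ _ := by rw [h3]; exact (abs_sub _ _).trans (add_le_add h4 h5)

/-- The star norm misses the L² norm only at the zero mode. There f'' vanishes, so the zero mode of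
the defect is that of the operator divided by α, up to a phase. -/
theorem norm_defect_sq_le (h' : M.Der f' f'') :
    M.δ * α ^ 2 * ‖M.defect l f‖ ^ 2 ≤
      2 * (M.δ * α ^ 2) * M.star (M.defect l f) ^ 2 + M.star (M.op α l f f'') ^ 2 := by
  have h1 := M.z_le (M.op α l f f'')
  have h2 : ‖M.z (M.op α l f f'')‖ = |α| * ‖M.z (M.defect l f)‖ := by
    rw [op, map_add, map_neg, M.z_der h', neg_zero, zero_add, map_smul, norm_smul, M.z_J,
      Real.norm_eq_abs]
  rw [h2, mul_pow, sq_abs] at h1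
  have h3 := M.norm_sq_le (M.defect l f)
  rw [← M.star_sq] at h1 h3
  have h4 := mul_le_mul_of_nonneg_left h3 (mul_nonneg M.δ_pos.le (sq_nonneg α))
  linarith

/-- Tests against A J f, for which the dissipative term vanishes. -/
theorem mul_inner_defect (h : M.Der f f') (h' : M.Der f' f'') :
    α * ⟪M.defect l f, M.A f⟫_ℝ = ⟪M.op α l f f'', M.A (M.J f)⟫_ℝ := by
  have h1 := M.ibp h' (M.der_A (M.der_J h))
  have h2 : ⟪f', M.A (M.J f')⟫_ℝ = 0 := by
    rw [← M.A_symm, real_inner_comm]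
    exact M.inner_J_A_self f'
  rw [op, inner_add_left, inner_neg_left, h1, h2, real_inner_smul_left, ← M.J_A, M.J_skew, M.J_sq,
    inner_neg_right]
  ring

theorem abs_mul_abs_inner_defect_le (h : M.Der f f') (h' : M.Der f' f'') :
    |α| * |⟪M.defect l f, M.A f⟫_ℝ| ≤ M.star (M.op α l f f'') * M.star f := by
  rw [← abs_mul, M.mul_inner_defect α l h h', ← M.star_J f]
  exact M.abs_inner_A_le _ _

/-- The virial identity: the right side is the defect tested against -2(c A f)' - A f. The s A f
part yields `low (A f)`; the l f part, split as f = A f + φ, yields another l times `low (A f)` plus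
the stream terms. -/
theorem low_add_stream_eq (h : M.Der f f') :
    (1 + l) * M.low (M.A f)
      + l * (⟪f - M.A f, M.A f⟫_ℝ - 2 * ⟪M.c (f' - M.A f'), M.A f⟫_ℝ)
    = -2 * ⟪M.c (M.A f'), M.defect l f⟫_ℝ + 2 * ⟪M.s (M.A f), M.defect l f⟫_ℝ
      - ⟪M.A f, M.defect l f⟫_ℝ := by
  have hu := M.der_A h
  have F1 := M.norm_s_sq_add_norm_c_sq (M.A f)
  have F2 := M.ibp (M.der_s hu) (M.der_c hu)
  have F3 := M.two_mul_inner_c_der hu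
  have F4 := M.ibp h (M.der_c hu)
  rw [defect]
  set u := M.A f
  set u' := M.A f'
  have F5 : ⟪M.s u', M.c u⟫_ℝ = ⟪M.s u, M.c u'⟫_ℝ := by
    rw [M.s_symm, M.s_c, ← M.c_symm, real_inner_comm]
  simp only [low, map_sub, inner_sub_left, inner_sub_right, inner_add_left,
    real_inner_smul_right, real_inner_self_eq_norm_sq, F5] at *
  have G1 := real_inner_comm (M.s u) (M.c u')
  have G2 := real_inner_comm u (M.s u)
  have G3 := real_inner_comm u f
  have G4 := real_inner_comm (M.s u) f
  have G5 := real_inner_comm (M.c u') f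
  have G6 := M.c_symm f' u
  linear_combination -F1 + F2 + l * F3 - 2 * l * G6 - 2 * l * F4 + l * G3 + 2 * G1 - G2
    - 2 * l * G4 + 2 * l * G5

/-- The multiplier is a polynomial in s A applied to f, so the skew term disappears. The derivative
terms bound ‖c A f'‖² from above, a gain near the critical points of s. -/
theorem inner_op_smoothing (h : M.Der f f') (h' : M.Der f' f'') :
    ⟪M.op α l f f'', M.A (f - M.s (M.A (M.s (M.A f))))⟫_ℝ
      = M.star f' ^ 2 - M.star (M.s (M.A f')) ^ 2 - M.star (M.s (M.A f)) ^ 2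
        + M.star (M.c (M.A f)) ^ 2 := by
  have hu := M.der_A h
  have hh := M.der_s hu
  have hq := M.der_A (M.der_sub h (M.der_s (M.der_A hh)))
  have h1 := M.ibp h' hq
  have h2 : ⟪M.J (M.defect l f), M.A (f - M.s (M.A (M.s (M.A f))))⟫_ℝ = 0 := by
    rw [map_sub, inner_sub_right, inner_J_defect, ← M.A_symm, ← M.J_A, defect]
    simp only [map_sub, map_smul, inner_sub_left, real_inner_smul_left]
    rw [M.inner_J_s_self, ← M.s_symm, ← M.J_s, M.inner_J_A_self]
    simp
  have h3 := M.ibp hh (M.der_A (M.der_c hu))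
  rw [op, inner_add_left, inner_neg_left, real_inner_smul_left, h2, h1]
  simp only [star_sq]
  rw [← M.A_symm f']
  set u := M.A f
  set u' := M.A f'
  simp only [map_add, map_sub, inner_add_left, inner_add_right, inner_sub_right] at *
  rw [← M.s_symm u' (M.A (M.s u')), ← M.s_symm u' (M.A (M.c u)), ← M.c_symm u' (M.A (M.s u))]
  have G1 : ⟪M.s u, M.A (M.c u')⟫_ℝ = ⟪M.c u', M.A (M.s u)⟫_ℝ := by
    rw [← M.A_symm, real_inner_comm]
  have G2 := real_inner_comm u' f'
  rw [G1] at h3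
  linarith

theorem op_weight_eq :
    f - M.s (M.A (M.s (M.A f)))
      = (1 - l ^ 2) • f - l • M.defect l f - M.s (M.A (M.defect l f)) := by
  simp only [defect, map_sub, map_smul]
  module

/-- Since s A f = l f up to the defect, the multiplier f - (s A)² f is (1 - l²) f up to defect
terms; near l = 1 this improves on ‖A f'‖² ≤ G. -/
theorem norm_c_A_der_sq_le (h : M.Der f f') (h' : M.Der f' f'') :
    ‖M.c (M.A f')‖ ^ 2 ≤ |1 - l ^ 2| * (M.star (M.op α l f f'') * M.star f)
      + (|l| + 1) * (M.star (M.op α l f f'') * M.star (M.defect l f)) + ‖M.A f‖ ^ 2 := by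
  have h1 := M.inner_op_smoothing α l h h'
  rw [M.op_weight_eq l] at h1
  simp only [map_sub, map_smul, inner_sub_right, real_inner_smul_right] at h1
  set g := M.op α l f f''
  set e := M.defect l f
  have b1 : (1 - l ^ 2) * ⟪g, M.A f⟫_ℝ ≤ |1 - l ^ 2| * (M.star g * M.star f) := by
    refine (le_abs_self _).trans ?_
    rw [abs_mul]
    exact mul_le_mul_of_nonneg_left (M.abs_inner_A_le _ _) (abs_nonneg _)
  have b2 : -(l * ⟪g, M.A e⟫_ℝ) ≤ |l| * (M.star g * M.star e) := by
    refine (neg_le_abs _).trans ?_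
    rw [abs_mul]
    exact mul_le_mul_of_nonneg_left (M.abs_inner_A_le _ _) (abs_nonneg _)
  have b3 : -⟪g, M.A (M.s (M.A e))⟫_ℝ ≤ M.star g * M.star e :=
    (neg_le_abs _).trans ((M.abs_inner_A_le _ _).trans
      (mul_le_mul_of_nonneg_left (M.star_s_A_le e) (M.star_nonneg _)))
  have b4 := M.norm_s_sq_add_norm_c_sq (M.A f')
  have b5 := pow_le_pow_left₀ (norm_nonneg _) (M.norm_A_le_star f') 2
  have b6 := pow_le_pow_left₀ (M.star_nonneg _) (M.star_le_norm (M.s (M.A f'))) 2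
  have b7 := pow_le_pow_left₀ (M.star_nonneg _)
    ((M.star_le_norm (M.s (M.A f))).trans (M.norm_s_le _)) 2
  linarith [sq_nonneg (M.star (M.c (M.A f)))]

/-! ### Consequences of the virial identity -/

theorem stream_nonneg (x : E) : 0 ≤ ⟪x - M.A x, M.A x⟫_ℝ := by
  rw [inner_sub_left, real_inner_self_eq_norm_sq]
  linarith [M.norm_A_sq_le x]

theorem norm_sq_sub_star_sq_A_le (x : E) :
    ‖M.A x‖ ^ 2 - M.star (M.A x) ^ 2 ≤ ⟪x - M.A x, M.A x⟫_ℝ := by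
  have h := M.A_nonneg (x - M.A x)
  rw [M.star_sq]
  have e1 := M.A_symm x (M.A x)
  simp only [map_sub, inner_sub_left, inner_sub_right, real_inner_self_eq_norm_sq] at *
  linarith

theorem norm_sq_sub_star_sq_nonneg (x : E) : 0 ≤ ‖x‖ ^ 2 - M.star x ^ 2 := by
  rw [M.star_sq]
  linarith [M.A_le x]

theorem norm_sq_sub_star_sq_sub_le (x y : E) :
    ‖x - y‖ ^ 2 - M.star (x - y) ^ 2
      ≤ 2 * (‖x‖ ^ 2 - M.star x ^ 2) + 2 * (‖y‖ ^ 2 - M.star y ^ 2) := by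
  have h := M.norm_sq_sub_star_sq_nonneg (x + y)
  simp only [M.star_sq, norm_sub_sq_real, norm_add_sq_real, map_add, map_sub, inner_add_left,
    inner_add_right, inner_sub_left, inner_sub_right] at *
  linarith

/-- Pairs f - (s A)² f with A f. What must be bounded is the form of 1 - A at s A f, seen as A f
minus the small A f - s A f. -/
theorem one_sub_sq_mul_star_sq_le (f : E) :
    (1 - l ^ 2) * M.star f ^ 2 ≤ ‖M.c (M.A f)‖ ^ 2 + 3 * ⟪f - M.A f, M.A f⟫_ℝ
      + 4 * M.low (M.A f) + (|l| + 1) * (M.star (M.defect l f) * M.star f) := by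
  have h1 : ⟪f - M.s (M.A (M.s (M.A f))), M.A f⟫_ℝ
      = M.star f ^ 2 - M.star (M.s (M.A f)) ^ 2 := by
    rw [inner_sub_left, M.s_symm, real_inner_comm (M.s (M.A f)), M.star_sq, M.star_sq]
  rw [M.op_weight_eq l] at h1
  simp only [inner_sub_left, real_inner_smul_left] at h1
  rw [← M.star_sq] at h1
  set e := M.defect l f
  have b1 : l * ⟪e, M.A f⟫_ℝ ≤ |l| * (M.star e * M.star f) := by
    refine (le_abs_self _).trans ?_
    rw [abs_mul]
    exact mul_le_mul_of_nonneg_left (M.abs_inner_A_le _ _) (abs_nonneg _)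
  have b2 : ⟪M.s (M.A e), M.A f⟫_ℝ ≤ M.star e * M.star f :=
    (M.inner_A_le _ _).trans (mul_le_mul_of_nonneg_right (M.star_s_A_le e) (M.star_nonneg _))
  have b3 := M.norm_sq_sub_star_sq_sub_le (M.A f) (M.A f - M.s (M.A f))
  rw [sub_sub_cancel] at b3
  have b4 := M.norm_sq_sub_star_sq_A_le f
  have b5 := M.norm_sub_s_sq_le (M.A f)
  have b6 := M.norm_s_sq_add_norm_c_sq (M.A f)
  have b7 : ⟪f - M.A f, M.A f⟫_ℝ = M.star f ^ 2 - ‖M.A f‖ ^ 2 := by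
    rw [inner_sub_left, real_inner_self_eq_norm_sq, M.star_sq]
  linarith [sq_nonneg (M.star (M.A f - M.s (M.A f)))]

theorem low_add_stream_le (h : M.Der f f') :
    (1 + l) * M.low (M.A f)
      + l * (⟪f - M.A f, M.A f⟫_ℝ - 2 * ⟪M.c (f' - M.A f'), M.A f⟫_ℝ)
    ≤ 2 * (‖M.defect l f‖ * ‖M.c (M.A f')‖) + 3 * (‖M.defect l f‖ * ‖M.A f‖) := by
  rw [M.low_add_stream_eq l h]
  have h1 := neg_le_of_abs_le (abs_real_inner_le_norm (M.c (M.A f')) (M.defect l f))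
  have h2 := real_inner_le_norm (M.s (M.A f)) (M.defect l f)
  have h3 := neg_le_of_abs_le (abs_real_inner_le_norm (M.A f) (M.defect l f))
  have h4 := mul_le_mul_of_nonneg_right (M.norm_s_le (M.A f)) (norm_nonneg (M.defect l f))
  linarith

theorem mul_stream_le (h : M.Der f f') (h' : M.Der f' f'') (hl : 0 ≤ l) {B : ℝ}
    (hB : (1 + l) * M.low (M.A f)
      + l * (⟪f - M.A f, M.A f⟫_ℝ - 2 * ⟪M.c (f' - M.A f'), M.A f⟫_ℝ) ≤ B) :
    M.low (M.A f) ≤ B ∧ l * M.high (f' - M.A f') ≤ B ∧ l * ⟪f - M.A f, M.A f⟫_ℝ ≤ 3 * B := by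
  have h1 := M.high_stream_le h h'
  have h2 := M.high_nonneg (f' - M.A f')
  have h3 := M.low_nonneg (M.A f)
  have h4 := M.two_mul_inner_c_le (f' - M.A f') (M.A f)
  have h5 := mul_le_mul_of_nonneg_left h1 hl
  have h6 := mul_nonneg hl h2
  have h7 := mul_nonneg hl h3
  have h8 := mul_le_mul_of_nonneg_left h4 hl
  refine ⟨?_, ?_, ?_⟩ <;> linarith

/-- Away from the extrema of the shear profile, `A f` is controlled by the defect. -/
theorem norm_A_sq_le_of_le_half (h : M.Der f f') (hl : 0 ≤ l) (hl2 : l ≤ 1 / 2) {B : ℝ}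
    (hlow : M.low (M.A f) ≤ B) (hhigh : l * M.high (f' - M.A f') ≤ B) :
    ‖M.A f‖ ^ 2 ≤ 228 * B + 108 * ‖M.defect l f‖ ^ 2 := by
  have hl1 : l ^ 2 ≤ 1 := by nlinarith
  -- This bounds `low (l φ)` by `low (A f)` and the defect; then `low φ` and `high φ'` together
  -- control ‖φ‖², through 2⟨c φ', φ⟩ = ⟨s φ, φ⟩.
  have e1 : l • (f - M.A f) = (M.s (M.A f) - l • M.A f) - M.defect l f := by
    rw [defect]; module
  have h1 := M.low_sub_le (M.s (M.A f) - l • M.A f) (M.defect l f)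
  have h2 := M.low_sub_le (M.s (M.A f)) (l • M.A f)
  rw [← e1, low_smul] at h1
  rw [low_smul] at h2
  have h3 := M.low_s_le (M.A f)
  have h4 := M.low_le (M.defect l f)
  have h5 := M.two_mul_inner_c_der (M.der_sub h (M.der_A h))
  have h6 := M.two_mul_inner_c_le (f' - M.A f') (f - M.A f)
  have h7 : M.low (f - M.A f) = ‖f - M.A f‖ ^ 2 - ⟪M.s (f - M.A f), f - M.A f⟫_ℝ := rfl
  have h8 : l ^ 2 * M.high (f' - M.A f') ≤ B := by
    refine le_trans ?_ hhigh
    exact mul_le_mul_of_nonneg_right (by nlinarith) (M.high_nonneg _)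
  have h9 := M.low_nonneg (M.A f)
  have h10 := M.low_nonneg (f - M.A f)
  have h11 : l ^ 2 * M.low (M.A f) ≤ M.low (M.A f) := by nlinarith
  have h12 : l ^ 2 * ‖f - M.A f‖ ^ 2 ≤ 17 * B + 8 * ‖M.defect l f‖ ^ 2 := by
    have : l ^ 2 * ‖f - M.A f‖ ^ 2
        ≤ 2 * (l ^ 2 * M.low (f - M.A f)) + l ^ 2 * M.high (f' - M.A f') := by
      have : ‖f - M.A f‖ ^ 2 ≤ 2 * M.low (f - M.A f) + M.high (f' - M.A f') := by linarith
      nlinarith [mul_le_mul_of_nonneg_left this (sq_nonneg l)]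
    linarith
  -- Here l ≤ 1/2 enters: every term on the right is now controlled, and 1 - l is at least 1/2.
  have e2 : (1 - l) • M.A f = (M.A f - M.s (M.A f)) + (l • (f - M.A f) + M.defect l f) := by
    rw [defect]; module
  have h13 : (1 - l) * ‖M.A f‖
      ≤ ‖M.A f - M.s (M.A f)‖ + (l * ‖f - M.A f‖ + ‖M.defect l f‖) := by
    have := norm_add_le (M.A f - M.s (M.A f)) (l • (f - M.A f) + M.defect l f)
    rw [← e2, norm_smul, Real.norm_of_nonneg (by linarith : (0 : ℝ) ≤ 1 - l)] at this
    refine this.trans (add_le_add le_rfl ((norm_add_le _ _).trans ?_))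
    rw [norm_smul, Real.norm_of_nonneg hl]
  have h14 := M.norm_sub_s_sq_le (M.A f)
  have h15 : ‖M.A f‖ / 2 ≤ ‖M.A f - M.s (M.A f)‖ + (l * ‖f - M.A f‖ + ‖M.defect l f‖) := by
    refine le_trans ?_ h13
    nlinarith [norm_nonneg (M.A f)]
  have h16 := pow_le_pow_left₀ (by positivity) h15 2
  have h17 : (‖M.A f - M.s (M.A f)‖ + (l * ‖f - M.A f‖ + ‖M.defect l f‖)) ^ 2
      ≤ 3 * (‖M.A f - M.s (M.A f)‖ ^ 2 + l ^ 2 * ‖f - M.A f‖ ^ 2 + ‖M.defect l f‖ ^ 2) := by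
    rw [← mul_pow]
    generalize ‖M.A f - M.s (M.A f)‖ = x
    generalize l * ‖f - M.A f‖ = y
    generalize ‖M.defect l f‖ = w
    nlinarith [sq_nonneg (x - y), sq_nonneg (x - w), sq_nonneg (y - w)]
  linarith

theorem δ_le_norm_A_sq (hf : M.star f = 1) : M.δ ≤ ‖M.A f‖ ^ 2 := by
  have := M.δ_le f
  rw [← M.star_sq, hf] at this
  linarith

theorem stream_eq (hf : M.star f = 1) : ⟪f - M.A f, M.A f⟫_ℝ = 1 - ‖M.A f‖ ^ 2 := by
  rw [inner_sub_left, real_inner_self_eq_norm_sq, ← M.star_sq, hf]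
  ring

/-! ### Scalar inequalities closing the three regimes -/

theorem false_of_one_le {U c d I G δ r : ℝ} (hr : 1 ≤ r)
    (hδ : 0 < δ) (hδU : δ ≤ U ^ 2) (hU : U ^ 2 ≤ 2 * c ^ 2 + 2 * (c * d)) (hc : c ^ 2 ≤ 2 * I)
    (hI : r ^ 4 * I ≤ G) (hd : d ^ 2 ≤ G) (hG : G ≤ 1 / 10 ^ 16 * δ * r ^ 2) : False := by
  have h1 : r ^ 2 * c ^ 2 ≤ 2 / 10 ^ 16 * δ := by
    have h0 := mul_le_mul_of_nonneg_left hc (by positivity : 0 ≤ r ^ 4)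
    have : r ^ 2 * (r ^ 2 * c ^ 2) ≤ r ^ 2 * (2 / 10 ^ 16 * δ) := by linarith
    exact le_of_mul_le_mul_left this (by positivity)
  have h2 : c ^ 2 ≤ r ^ 2 * c ^ 2 := le_mul_of_one_le_left (sq_nonneg c) (one_le_pow₀ hr)
  have h3 : (c * d) ^ 2 ≤ (2 / 10 ^ 16 * δ) ^ 2 := by
    have : c ^ 2 * d ^ 2 ≤ c ^ 2 * (1 / 10 ^ 16 * δ * r ^ 2) :=
      mul_le_mul_of_nonneg_left (hd.trans hG) (sq_nonneg c)
    have h4 : r ^ 2 * c ^ 2 * δ ≤ 2 / 10 ^ 16 * δ * δ := mul_le_mul_of_nonneg_right h1 hδ.le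
    have h5 := mul_pos hδ hδ
    rw [mul_pow, mul_pow, sq δ]
    linarith
  have h4 := (abs_le_of_sq_le_sq' h3 (by positivity)).2
  linarith

/-- Dividing by δ r⁴ shows that the zero-mode correction G² is negligible under the smallness
assumption on G. -/
theorem norm_defect_scaled_le {S T Q G δ r : ℝ} (hr : 0 < r) (hδ : 0 < δ) (hδQ : δ ≤ Q)
    (hT : δ * (r ^ 4) ^ 2 * T ^ 2 ≤ 2 * (δ * (r ^ 4) ^ 2) * S ^ 2 + G ^ 2)
    (hG0 : 0 ≤ G) (hG : G ≤ 1 / 10 ^ 16 * δ * r ^ 2) :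
    r ^ 4 * T ^ 2 ≤ 2 * (r ^ 4 * S ^ 2) + 1 / 10 ^ 16 * Q := by
  have b1 : G ^ 2 ≤ (1 / 10 ^ 16 * δ * r ^ 2) ^ 2 := by gcongr
  have b2 : δ * r ^ 4 * (1 / 10 ^ 32 * δ) ≤ δ * r ^ 4 * (1 / 10 ^ 16 * Q) := by
    gcongr <;> norm_num
  have b3 : δ * r ^ 4 * (r ^ 4 * T ^ 2) ≤ δ * r ^ 4 * (2 * (r ^ 4 * S ^ 2) + 1 / 10 ^ 16 * Q) := by
    linarith
  exact le_of_mul_le_mul_left b3 (by positivity)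

theorem false_of_le_half {U c d v S T G δ r : ℝ} (hc0 : 0 ≤ c) (hU0 : 0 ≤ U)
    (hS0 : 0 ≤ S) (hr : 1 ≤ r) (hδ : 0 < δ)
    (hδU : δ ≤ U ^ 2) (hU1 : U ≤ 1) (hc : c ≤ U) (hd : d ^ 2 ≤ G) (hv : v ≤ d) (hST : S ≤ T)
    (hU : U ^ 2 ≤ 228 * (2 * (T * v) + 3 * (T * U)) + 108 * T ^ 2)
    (hS : r ^ 4 * S ^ 2 ≤ G * S + d * c)
    (hT : δ * (r ^ 4) ^ 2 * T ^ 2 ≤ 2 * (δ * (r ^ 4) ^ 2) * S ^ 2 + G ^ 2)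
    (hG0 : 0 ≤ G) (hG : G ≤ 1 / 10 ^ 16 * δ * r ^ 2) : False := by
  have hr0 : 0 < r := by linarith
  have hT0 : 0 ≤ T := hS0.trans hST
  have hU2 : 0 < U ^ 2 := hδ.trans_le hδU
  have hT2 := norm_defect_scaled_le hr0 hδ hδU hT hG0 hG
  clear hT
  have hGU : G ≤ 1 / 10 ^ 16 * U ^ 2 * r ^ 2 := hG.trans (by gcongr)
  have hdU : d ≤ 1 / 10 ^ 8 * (U * r) := by
    refine (abs_le_of_sq_le_sq' ?_ (by positivity)).2
    refine (hd.trans hGU).trans (le_of_eq ?_)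
    ring
  -- The natural scale: ‖A f'‖ is at most 10⁻⁸ U r, so T v is at most 10⁻⁸ U p, and the defect
  -- bounds give p ≤ 2·10⁻⁴ U.
  obtain ⟨p, hp⟩ : ∃ p, p = r * T := ⟨_, rfl⟩
  have hp0 : 0 ≤ p := by rw [hp]; positivity
  have hTp : T ≤ p := hp ▸ le_mul_of_one_le_left hT0 hr
  have hTv : T * v ≤ 1 / 10 ^ 8 * (U * p) := by
    calc T * v ≤ T * (1 / 10 ^ 8 * (U * r)) := by gcongr; linarith
      _ = _ := by rw [hp]; ring
  have hTU : T * U ≤ U * p := by rw [mul_comm]; gcongr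
  have hTT : T ^ 2 ≤ p ^ 2 := by gcongr
  have h1 : r ^ 4 * S ^ 2 ≤ r ^ 2 * (1 / 10 ^ 16 * (U * p) + 1 / 10 ^ 8 * U ^ 2) := by
    have a1 : G * S ≤ 1 / 10 ^ 16 * U ^ 2 * r ^ 2 * T := by gcongr
    have a2 : d * c ≤ 1 / 10 ^ 8 * (U * r) * U := by gcongr
    have a3 : r ^ 2 * (U ^ 2 * T) ≤ r ^ 2 * (U * p) := by
      calc r ^ 2 * (U ^ 2 * T) = r ^ 2 * (U * (U * T)) := by ring
        _ ≤ r ^ 2 * (U * (1 * p)) := by gcongr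
        _ = r ^ 2 * (U * p) := by ring
    have a4 : U ^ 2 * r ≤ U ^ 2 * r ^ 2 := by
      gcongr
      exact le_self_pow₀ hr (by norm_num)
    linarith
  have h2 : p ^ 2 ≤ 2 * (1 / 10 ^ 16 * (U * p) + 1 / 10 ^ 8 * U ^ 2) + 1 / 10 ^ 16 * U ^ 2 := by
    have b1 : U ^ 2 ≤ r ^ 2 * U ^ 2 := le_mul_of_one_le_left hU2.le (one_le_pow₀ hr)
    have b2 : r ^ 2 * p ^ 2 = r ^ 4 * T ^ 2 := by rw [hp]; ring
    have b3 : r ^ 2 * p ^ 2 ≤ r ^ 2 *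
        (2 * (1 / 10 ^ 16 * (U * p) + 1 / 10 ^ 8 * U ^ 2) + 1 / 10 ^ 16 * U ^ 2) := by
      linarith
    exact le_of_mul_le_mul_left b3 (by positivity)
  have hm : 2 * (U * p) ≤ U ^ 2 + p ^ 2 := by linarith [two_mul_le_add_sq U p]
  have h3 : p ≤ 2 / 10 ^ 4 * U := by
    refine (abs_le_of_sq_le_sq' ?_ (by positivity)).2
    rw [mul_pow]
    linarith
  have h4 : U * p ≤ U * (2 / 10 ^ 4 * U) := by gcongr
  have h5 : p ^ 2 ≤ (2 / 10 ^ 4 * U) ^ 2 := by gcongr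
  rw [mul_pow] at h5
  linarith

theorem le_of_sq_le_quadratic {v w : ℝ} (hw : 0 ≤ w) (h : v ^ 2 ≤ 48 * (w * v) + 76 * w + 1) :
    v ≤ 49 * w + 9 := by
  by_contra! hlt
  have hv : 0 < v := by linarith
  have h1 := mul_lt_mul_of_pos_right hlt hv
  have h2 := mul_nonneg hw hv.le
  rw [sq] at h
  linarith

theorem false_of_half_le {U c d v S T G κ B δ r : ℝ} (hc0 : 0 ≤ c) (hU0 : 0 ≤ U) (hv0 : 0 ≤ v)
    (hd0 : 0 ≤ d) (hS0 : 0 ≤ S) (hr : 1 ≤ r) (hδ : 0 < δ) (hδ1 : δ ≤ 1)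
    (hU1 : U ≤ 1) (hB : B = 2 * (T * v) + 3 * (T * U)) (hc : c ^ 2 ≤ 2 * B) (hd : d ^ 2 ≤ G)
    (hST : S ≤ T) (hU : U ^ 2 ≤ 2 * c ^ 2 + 2 * (c * d)) (hUB : 1 ≤ U ^ 2 + 6 * B)
    (hv : v ^ 2 ≤ κ * G + 2 * (G * S) + U ^ 2) (hκ : κ ≤ 24 * B + 2 * S)
    (hS : r ^ 4 * S ^ 2 ≤ G * S + d * c)
    (hT : δ * (r ^ 4) ^ 2 * T ^ 2 ≤ 2 * (δ * (r ^ 4) ^ 2) * S ^ 2 + G ^ 2)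
    (hG0 : 0 ≤ G) (hG : G ≤ 1 / 10 ^ 16 * δ * r ^ 2) : False := by
  have hr0 : 0 < r := by linarith
  have hT0 : 0 ≤ T := hS0.trans hST
  have hT2 := norm_defect_scaled_le hr0 hδ hδ1 hT hG0 hG
  clear hT
  have hG1 : G ≤ 1 / 10 ^ 16 * r ^ 2 := by
    refine hG.trans ?_
    gcongr
    linarith
  have hTU : T * U ≤ T := mul_le_of_le_one_right hT0 hU1
  have hB0 : 0 ≤ B := by rw [hB]; positivity
  -- B contains v itself, so the smoothing bound is quadratic in v and must be solved, with w = G T.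
  have hv2 : v ≤ 49 * (G * T) + 9 := by
    refine le_of_sq_le_quadratic (by positivity) ?_
    have a1 : κ * G ≤ (24 * B + 2 * S) * G := mul_le_mul_of_nonneg_right hκ hG0
    have a2 : G * S ≤ G * T := mul_le_mul_of_nonneg_left hST hG0
    have a3 := mul_le_mul_of_nonneg_left hTU hG0
    have a4 : U ^ 2 ≤ 1 := pow_le_one₀ hU0 hU1
    have a5 : G * B = 2 * (G * T * v) + 3 * (G * (T * U)) := by rw [hB]; ring
    linarith
  have hB1 : B ≤ 98 * (G * T ^ 2) + 21 * T := by
    have := mul_le_mul_of_nonneg_left hv2 hT0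
    rw [hB]; linarith
  -- At this scale x² = |α|T², and both B and c d are controlled by x; x ≤ 10⁻³ then makes U² small,
  -- against 1 ≤ U² + 6B.
  obtain ⟨x, hx⟩ : ∃ x, x = r ^ 2 * T := ⟨_, rfl⟩
  have hx0 : 0 ≤ x := by rw [hx]; positivity
  have hBx : r ^ 2 * B ≤ 98 / 10 ^ 16 * x ^ 2 + 21 * x := by
    have a1 : r ^ 2 * B ≤ r ^ 2 * (98 * (G * T ^ 2) + 21 * T) := by gcongr
    have a2 : G * (r ^ 2 * T ^ 2) ≤ 1 / 10 ^ 16 * r ^ 2 * (r ^ 2 * T ^ 2) := by gcongr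
    have e1 : x ^ 2 = r ^ 2 * (r ^ 2 * T ^ 2) := by rw [hx]; ring
    rw [e1]
    linarith
  have hBle : B ≤ r ^ 2 * B := le_mul_of_one_le_left hB0 (one_le_pow₀ hr)
  have hq : (c * d) ^ 2 ≤ 2 / 10 ^ 16 * (98 / 10 ^ 16 * x ^ 2 + 21 * x) := by
    have a1 : c ^ 2 * d ^ 2 ≤ 2 * B * (1 / 10 ^ 16 * r ^ 2) := by
      gcongr
      exact hd.trans hG1
    rw [mul_pow]
    linarith
  have hq0 : 0 ≤ c * d := by positivity
  have hxx : x ^ 2 ≤ 2 / 10 ^ 16 * x + 2 * (c * d) + 1 / 10 ^ 16 := by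
    have a1 : G * S ≤ 1 / 10 ^ 16 * x := by
      calc G * S ≤ 1 / 10 ^ 16 * r ^ 2 * T := by gcongr
        _ = _ := by rw [hx]; ring
    have e1 : x ^ 2 = r ^ 4 * T ^ 2 := by rw [hx]; ring
    rw [e1]
    linarith
  have hx1 : x ≤ 1 / 10 ^ 3 := by
    by_contra! hlt
    have a0 : 1 / 10 ^ 3 * x ≤ x ^ 2 := by
      rw [sq]
      exact mul_le_mul_of_nonneg_right hlt.le hx0
    have a1 : (c * d) ^ 2 ≤ (1 / 10 ^ 5 * x) ^ 2 := by
      rw [mul_pow (1 / 10 ^ 5 : ℝ)]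
      linarith
    have a2 := (abs_le_of_sq_le_sq' a1 (by positivity)).2
    linarith
  have hx2 : x ^ 2 ≤ x := by
    rw [sq]
    exact mul_le_of_le_one_left hx0 (by linarith)
  have hq1 : c * d ≤ 1 / 10 ^ 3 := by
    refine (abs_le_of_sq_le_sq' ?_ (by positivity)).2
    linarith
  linarith

/-- The pseudospectral lower bound for a nonnegative spectral parameter. -/
theorem mul_sqrt_lt_star_op_of_nonneg (hα : 1 ≤ |α|) (hl : 0 ≤ l) (h : M.Der f f')
    (h' : M.Der f' f'') (hf : M.star f = 1) :
    1 / 10 ^ 16 * M.δ * √|α| < M.star (M.op α l f f'') := by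
  by_contra! hG
  -- r = |α|^{1/4} is the inverse width of the layer at a critical point of s.
  obtain ⟨r, hr, hrα⟩ : ∃ r : ℝ, 1 ≤ r ∧ |α| = r ^ 4 := by
    refine ⟨√√|α|, ?_, ?_⟩
    · rw [Real.one_le_sqrt, Real.one_le_sqrt]; exact hα
    · have : (√√|α|) ^ 4 = ((√√|α|) ^ 2) ^ 2 := by ring
      rw [this, Real.sq_sqrt (Real.sqrt_nonneg _), Real.sq_sqrt (abs_nonneg _)]
  have hα2 : α ^ 2 = (r ^ 4) ^ 2 := by rw [← hrα, sq_abs]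
  have hs : √|α| = r ^ 2 := by
    rw [hrα, show r ^ 4 = (r ^ 2) ^ 2 by ring, Real.sqrt_sq (by positivity)]
  rw [hs] at hG
  have hU : ‖M.A f‖ ≤ 1 := hf ▸ M.norm_A_le_star f
  have hδU := M.δ_le_norm_A_sq hf
  have hδ := M.δ_pos
  have hhardy := M.norm_sq_le_norm_c (M.der_A h)
  have hc := M.norm_c_sq_le (M.A f)
  have hd := M.norm_A_der_sq_le α l h h'
  rw [hf, mul_one] at hd
  have hS := M.abs_mul_star_defect_sq_le α l h h'
  rw [hrα] at hS
  have hT := M.norm_defect_sq_le α l h' (f := f)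
  rw [hα2] at hT
  have hST := M.star_le_norm (M.defect l f)
  have hstream := M.stream_eq hf
  rcases le_or_gt 1 l with h1 | h1
  · have hI := M.abs_mul_abs_inner_defect_le α l h h'
    rw [hf, mul_one, hrα] at hI
    -- -⟨e, A f⟩ = l‖f‖_*² - ⟨s A f, A f⟩, where l ≥ 1 and ‖f‖_* = 1 ≥ ‖A f‖.
    have hlow : M.low (M.A f) ≤ |⟪M.defect l f, M.A f⟫_ℝ| := by
      refine le_trans ?_ (neg_le_abs _)
      rw [low, defect, inner_sub_left, real_inner_smul_left, ← M.star_sq, hf]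
      nlinarith [norm_nonneg (M.A f)]
    exact false_of_one_le hr hδ hδU hhardy
      (hc.trans (mul_le_mul_of_nonneg_left hlow zero_le_two)) hI hd hG
  obtain ⟨hlow, hhigh, hst⟩ := M.mul_stream_le l h h' hl (M.low_add_stream_le l h)
  rcases le_total l (1 / 2) with h2 | h2
  · exact false_of_le_half (norm_nonneg _) (norm_nonneg _)
      (M.star_nonneg _) hr hδ hδU hU (M.norm_c_le _) hd (M.norm_c_le _) hST
      (M.norm_A_sq_le_of_le_half l h hl h2 hlow hhigh) hS hT (M.star_nonneg _) hG
  · have hv := M.norm_c_A_der_sq_le α l h h'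
    have hκ := M.one_sub_sq_mul_star_sq_le l f
    have hl2 : 0 ≤ 1 - l ^ 2 := by nlinarith
    rw [hf, abs_of_nonneg hl] at hv hκ
    rw [abs_of_nonneg hl2] at hv
    have hst0 := M.stream_nonneg f
    have hst6 := mul_le_mul_of_nonneg_right h2 hst0
    have hGS := mul_nonneg (M.star_nonneg (M.op α l f f'')) (M.star_nonneg (M.defect l f))
    have hGS2 := mul_le_mul_of_nonneg_right h1.le hGS
    have hS2 := mul_le_mul_of_nonneg_right h1.le (M.star_nonneg (M.defect l f))
    refine false_of_half_le (κ := 1 - l ^ 2) (norm_nonneg _) (norm_nonneg _) (norm_nonneg _)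
      (norm_nonneg _) (M.star_nonneg _) hr hδ (hδU.trans (pow_le_one₀ (norm_nonneg _) hU))
      hU rfl (by linarith) hd hST hhardy (by linarith) ?_ ?_ hS hT (M.star_nonneg _) hG
    · linarith
    · linarith

theorem op_neg : M.neg.op (-α) (-l) f f'' = M.op α l f f'' := by
  simp only [op, defect, neg, LinearMap.neg_apply, map_sub, map_neg, map_smul]
  module

/-- The pseudospectral lower bound for a spectral parameter of either sign. -/
theorem mul_sqrt_le_star_op (hα : 1 ≤ |α|) (h : M.Der f f') (h' : M.Der f' f'')
    (hf : M.star f = 1) :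
    1 / 10 ^ 16 * M.δ * √|α| ≤ M.star (M.op α l f f'') := by
  rcases le_total 0 l with hl | hl
  · exact (M.mul_sqrt_lt_star_op_of_nonneg α l hα hl h h' hf).le
  · have := M.neg.mul_sqrt_lt_star_op_of_nonneg (-α) (-l) (by rwa [abs_neg])
      (neg_nonneg.2 hl) h h' hf
    rw [op_neg, abs_neg] at this
    exact this.le

end ShearSystem

/-! ### The Fourier model on the torus -/

theorem coeff_real_smul (r : ℝ) (f : L2) (n : ℤ) : coeff (r • f) n = r * coeff f n := by
  rw [← coeff_smul]
  congr 1

theorem coeff_neg (f : L2) (n : ℤ) : coeff (-f) n = -coeff f n := by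
  have := coeff_smul (-1) f n
  simpa using this

theorem memlp_coeff_shift (k : ℤ) (f : L2) : Memℓp (fun n => coeff f (n - k)) 2 := by
  have hf := (memlp_coeff f).summable (by norm_num)
  exact memℓp_gen ((Equiv.subRight k).summable_iff.2 hf)

/-- Multiplication by `exp(i k y)`. -/
noncomputable def shift (k : ℤ) : L2 →ₗ[ℂ] L2 where
  toFun f := ofCoeff _ (memlp_coeff_shift k f)
  map_add' f g := coeff_injective fun n => by
    rw [coeff_add, coeff_ofCoeff, coeff_ofCoeff, coeff_ofCoeff, coeff_add]
  map_smul' r f := coeff_injective fun n => by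
    rw [RingHom.id_apply, coeff_smul, coeff_ofCoeff, coeff_ofCoeff, coeff_smul]

theorem coeff_shift (k : ℤ) (f : L2) (n : ℤ) : coeff (shift k f) n = coeff f (n - k) :=
  coeff_ofCoeff _ (memlp_coeff_shift k f) n

theorem sinTorus_eq (t : Torus) :
    (sinTorus t : ℂ) = -(Complex.I / 2) * (fourier 1 t - fourier (-1) t) := by
  induction t using QuotientAddGroup.induction_on with
  | H x =>
    have h : sinTorus (x : Torus) = Real.sin x := rfl
    have e : ∀ n : ℤ, (fourier n (x : Torus) : ℂ) = Complex.exp (n * x * Complex.I) := by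
      intro n
      rw [fourier_coe_apply]
      congr 1
      have : (Real.pi : ℂ) ≠ 0 := by exact_mod_cast Real.pi_ne_zero
      push_cast
      field_simp
    change ((sinTorus (x : Torus) : ℝ) : ℂ) = -(Complex.I / 2) *
      (fourier 1 (x : Torus) - fourier (-1) (x : Torus))
    rw [h, e, e, Complex.ofReal_sin, Complex.sin]
    push_cast
    rw [neg_one_mul, one_mul]
    ring

theorem integrable_fourier_mul (f : L2) (n : ℤ) :
    Integrable (fun t : Torus => fourier n t * f t) AddCircle.haarAddCircle := by
  have hf : Integrable f (AddCircle.haarAddCircle : Measure Torus) :=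
    (Lp.memLp f).integrable (by norm_num)
  exact hf.fourier_smul n

theorem coeff_sinMul (f : L2) (n : ℤ) :
    coeff (sinMul f) n = -(Complex.I / 2) * (coeff f (n - 1) - coeff f (n + 1)) := by
  have h : (sinMul f : Torus → ℂ) =ᵐ[AddCircle.haarAddCircle]
      fun y => (sinTorus y : ℂ) * f y := MemLp.coeFn_toLp (memLp_sin_mul f)
  simp only [coeff, fourierCoeff, smul_eq_mul]
  rw [← integral_sub (integrable_fourier_mul f _) (integrable_fourier_mul f _),
    ← integral_const_mul]
  refine integral_congr_ae ?_
  filter_upwards [h] with t ht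
  rw [ht, sinTorus_eq, show -(n - 1) = -n + 1 by ring, show -(n + 1) = -n + -1 by ring,
    fourier_add, fourier_add]
  ring

theorem sinMul_eq (f : L2) : sinMul f = -(Complex.I / 2) • (shift 1 f - shift (-1) f) :=
  coeff_injective fun n => by
    rw [coeff_sinMul, coeff_smul, coeff_sub, coeff_shift, coeff_shift, sub_neg_eq_add]

/-- Multiplication by `cos y`. -/
noncomputable def cosMul : L2 →ₗ[ℂ] L2 := (1 / 2 : ℂ) • (shift 1 + shift (-1))

theorem coeff_cosMul (f : L2) (n : ℤ) :
    coeff (cosMul f) n = 1 / 2 * (coeff f (n - 1) + coeff f (n + 1)) := by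
  rw [cosMul, LinearMap.smul_apply, LinearMap.add_apply, coeff_smul, coeff_add, coeff_shift,
    coeff_shift, sub_neg_eq_add]

theorem real_inner_eq_re (f g : L2) : ⟪f, g⟫_ℝ = RCLike.re ⟪f, g⟫_ℂ := by
  rw [L2.inner_def, L2.inner_def, ← integral_re (L2.integrable_inner f g)]
  rfl

theorem hasSum_real_inner (f g : L2) :
    HasSum (fun n => (coeff g n * starRingEnd ℂ (coeff f n)).re) ⟪f, g⟫_ℝ := by
  have h := fourierBasis.hasSum_inner_mul_inner f g
  have h2 := Complex.hasSum_re h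
  rw [real_inner_eq_re]
  change HasSum _ (Complex.re _)
  convert h2 using 3 with n
  rw [← inner_conj_symm f, ← fourierBasis.repr_apply_apply, ← fourierBasis.repr_apply_apply,
    ← coeff_eq_repr, ← coeff_eq_repr, mul_comm]

theorem real_inner_congr {f g h k : L2}
    (H : ∀ n, (coeff g n * starRingEnd ℂ (coeff f n)).re
      = (coeff k n * starRingEnd ℂ (coeff h n)).re) : ⟪f, g⟫_ℝ = ⟪h, k⟫_ℝ :=
  (hasSum_real_inner f g).unique (by simpa only [H] using hasSum_real_inner h k)

theorem real_inner_shift (k : ℤ) (f g : L2) : ⟪shift k f, g⟫_ℝ = ⟪f, shift (-k) g⟫_ℝ := by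
  refine (hasSum_real_inner _ _).unique ?_
  have h := (Equiv.subRight k).hasSum_iff.2 (hasSum_real_inner f (shift (-k) g))
  convert h using 2 with n
  simp [coeff_shift]

theorem real_inner_I_smul (f g : L2) : ⟪Complex.I • f, g⟫_ℝ = -⟪f, Complex.I • g⟫_ℝ := by
  rw [← inner_neg_right]
  refine real_inner_congr fun n => ?_
  rw [coeff_smul, coeff_neg, coeff_smul, map_mul, Complex.conj_I]
  congr 1
  ring

theorem real_inner_neg_half_I_smul (f g : L2) :
    ⟪(-(Complex.I / 2)) • f, g⟫_ℝ = -⟪f, (-(Complex.I / 2)) • g⟫_ℝ := by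
  rw [← inner_neg_right]
  refine real_inner_congr fun n => ?_
  rw [coeff_smul, coeff_neg, coeff_smul, map_mul, map_neg, map_div₀, Complex.conj_I, map_ofNat]
  congr 1
  ring

theorem real_inner_half_smul (f g : L2) :
    ⟪(1 / 2 : ℂ) • f, g⟫_ℝ = ⟪f, (1 / 2 : ℂ) • g⟫_ℝ := by
  refine real_inner_congr fun n => ?_
  rw [coeff_smul, coeff_smul, map_mul, map_div₀, map_one, map_ofNat]
  congr 1
  ring

theorem sinMul_symm (f g : L2) : ⟪sinMul f, g⟫_ℝ = ⟪f, sinMul g⟫_ℝ := by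
  rw [sinMul_eq, sinMul_eq, real_inner_neg_half_I_smul, inner_sub_left, real_inner_shift,
    real_inner_shift, neg_neg, map_smul, map_smul, ← inner_sub_right, ← inner_neg_right,
    ← smul_sub, ← smul_neg, neg_sub]

theorem cosMul_symm (f g : L2) : ⟪cosMul f, g⟫_ℝ = ⟪f, cosMul g⟫_ℝ := by
  rw [cosMul, LinearMap.smul_apply, LinearMap.smul_apply, LinearMap.add_apply,
    LinearMap.add_apply, real_inner_half_smul, inner_add_left, real_inner_shift,
    real_inner_shift, neg_neg, map_smul, map_smul, ← inner_add_right, ← smul_add, add_comm]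

theorem hasSum_norm_sq (f : L2) : HasSum (fun n => ‖coeff f n‖ ^ 2) (‖f‖ ^ 2) := by
  have h := hasSum_real_inner f f
  rw [real_inner_self_eq_norm_sq] at h
  convert h using 2 with n
  rw [Complex.mul_conj, Complex.normSq_eq_norm_sq, Complex.ofReal_re]

theorem hasSum_real_inner_multiplier {A : L2 → L2} {a : ℤ → ℝ}
    (hA : ∀ f n, coeff (A f) n = a n * coeff f n) (f : L2) :
    HasSum (fun n => a n * ‖coeff f n‖ ^ 2) ⟪f, A f⟫_ℝ := by
  have h := hasSum_real_inner f (A f)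
  convert h using 2 with n
  rw [hA, mul_assoc, Complex.mul_conj, Complex.normSq_eq_norm_sq, ← Complex.ofReal_mul,
    Complex.ofReal_re]

theorem hasSum_norm_sq_multiplier {A : L2 → L2} {a : ℤ → ℝ}
    (hA : ∀ f n, coeff (A f) n = a n * coeff f n) (f : L2) :
    HasSum (fun n => a n ^ 2 * ‖coeff f n‖ ^ 2) (‖A f‖ ^ 2) := by
  have h := hasSum_norm_sq (A f)
  convert h using 2 with n
  rw [hA, norm_mul, Complex.norm_real, mul_pow, Real.norm_eq_abs, sq_abs]

/-- The graph of the derivative on the torus. -/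
def IsDeriv (f f' : L2) : Prop := ∀ n : ℤ, coeff f' n = Complex.I * n * coeff f n

/-- The concrete system on `L²` of the torus, for a Fourier multiplier `A` with symbol `a`. -/
noncomputable def shearSystem (A : L2 →ₗ[ℂ] L2) (a : ℤ → ℝ) (δ : ℝ)
    (hA : ∀ f n, coeff (A f) n = a n * coeff f n) (hδ : 0 < δ) (hδa : ∀ n, δ ≤ a n)
    (ha1 : ∀ n, a n ≤ 1) (ha2 : ∀ n, n ≠ 0 → 1 / 2 ≤ a n)
    (hs : (∀ n, a n = 1) ∨ ∃ b : ℝ, 0 ≤ b ∧ ∀ n : ℤ, a n = (b + (n : ℝ) ^ 2) * (1 - a n)) :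
    ShearSystem L2 where
  s := sinMul.restrictScalars ℝ
  c := cosMul.restrictScalars ℝ
  A := A.restrictScalars ℝ
  J := ((Complex.I : ℂ) • (LinearMap.id : L2 →ₗ[ℂ] L2)).restrictScalars ℝ
  z := { toFun := fun f => coeff f 0
         map_add' := fun f g => coeff_add f g 0
         map_smul' := fun r f => by
          rw [coeff_real_smul, RingHom.id_apply, Complex.real_smul] }
  δ := δ
  Der := IsDeriv
  s_symm := sinMul_symm
  c_symm := cosMul_symm
  A_symm f g := real_inner_congr fun n => by
    simp only [LinearMap.coe_restrictScalars, hA, map_mul, Complex.conj_ofReal]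
    congr 1
    ring
  J_skew := real_inner_I_smul
  J_sq f := coeff_injective fun n => by
    simp only [LinearMap.coe_restrictScalars, LinearMap.smul_apply, LinearMap.id_apply,
      coeff_smul, coeff_neg]
    rw [← mul_assoc, Complex.I_mul_I, neg_one_mul]
  s_c f := coeff_injective fun n => by
    simp only [LinearMap.coe_restrictScalars, coeff_sinMul, coeff_cosMul, sub_add_cancel,
      add_sub_cancel_right]
    ring
  sq_add_sq f := coeff_injective fun n => by
    simp only [LinearMap.coe_restrictScalars, coeff_sinMul, coeff_cosMul, coeff_add,
      sub_add_cancel, add_sub_cancel_right]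
    linear_combination (1 / 4 * (coeff f (n - 1 - 1) - coeff f n
      - (coeff f n - coeff f (n + 1 + 1)))) * Complex.I_sq
  J_s f := (map_smul sinMul Complex.I f).symm
  J_A f := (map_smul A Complex.I f).symm
  der_sub h k n := by
    rw [coeff_sub, coeff_sub, h, k]
    ring
  der_smul r _ _ h n := by
    rw [coeff_real_smul, coeff_real_smul, h]
    ring
  der_J h n := by
    simp only [LinearMap.coe_restrictScalars, LinearMap.smul_apply, LinearMap.id_apply,
      coeff_smul, h n]
    ring
  der_s h n := by
    simp only [LinearMap.coe_restrictScalars, coeff_sinMul, coeff_cosMul, coeff_add, h (n - 1),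
      h (n + 1)]
    push_cast
    linear_combination (1 / 2 * (coeff _ (n - 1) + coeff _ (n + 1))) * Complex.I_sq
  der_c h n := by
    simp only [LinearMap.coe_restrictScalars, coeff_sinMul, coeff_cosMul, coeff_sub, h (n - 1),
      h (n + 1)]
    push_cast
    ring
  der_A h n := by
    simp only [LinearMap.coe_restrictScalars, hA, h n]
    ring
  ibp h k := by
    rw [← inner_neg_right]
    refine real_inner_congr fun n => ?_
    rw [coeff_neg, h, k]
    simp only [map_mul, Complex.conj_I, map_intCast]
    congr 1
    ring
  z_der h := by
    change coeff _ 0 = 0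
    rw [h 0]
    simp
  z_J f := by
    change ‖coeff (Complex.I • f) 0‖ = ‖coeff f 0‖
    rw [coeff_smul, norm_mul, Complex.norm_I, one_mul]
  δ_pos := hδ
  δ_le f := hasSum_le (fun n => by
      rw [← mul_assoc, sq (a n)]
      exact mul_le_mul_of_nonneg_right
        (mul_le_mul_of_nonneg_right (hδa n) (hδ.le.trans (hδa n))) (sq_nonneg _))
    ((hasSum_real_inner_multiplier hA f).mul_left δ) (hasSum_norm_sq_multiplier hA f)
  norm_A_sq_le f := hasSum_le (fun n => by
      rw [sq (a n)]
      exact mul_le_mul_of_nonneg_right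
        (mul_le_of_le_one_left (hδ.le.trans (hδa n)) (ha1 n)) (sq_nonneg _))
    (hasSum_norm_sq_multiplier hA f) (hasSum_real_inner_multiplier hA f)
  A_le f := hasSum_le (fun n => mul_le_of_le_one_left (sq_nonneg _) (ha1 n))
    (hasSum_real_inner_multiplier hA f) (hasSum_norm_sq f)
  norm_sq_le f := by
    refine hasSum_le (fun n => ?_) (hasSum_norm_sq f)
      (((hasSum_real_inner_multiplier hA f).mul_left 2).add
        (hasSum_ite_eq (0 : ℤ) (‖coeff f 0‖ ^ 2)))
    have h0 := hδ.le.trans (hδa n)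
    split_ifs with h
    · subst h
      have := mul_nonneg h0 (sq_nonneg ‖coeff f 0‖)
      linarith
    · have := mul_le_mul_of_nonneg_right (ha2 n h) (sq_nonneg ‖coeff f n‖)
      linarith
  z_le f := by
    have h := le_hasSum (hasSum_real_inner_multiplier hA f) 0 fun n _ =>
      mul_nonneg (hδ.le.trans (hδa n)) (sq_nonneg _)
    exact (mul_le_mul_of_nonneg_right (hδa 0) (sq_nonneg _)).trans h
  stream := by
    rcases hs with h | ⟨b, hb, h⟩
    · left
      intro f
      refine coeff_injective fun n => ?_
      rw [LinearMap.coe_restrictScalars, hA, h]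
      simp
    · refine Or.inr ⟨b, hb, fun {f f' f''} h1 h2 => coeff_injective fun n => ?_⟩
      simp only [LinearMap.coe_restrictScalars, hA, coeff_sub, coeff_real_smul, h2 n, h1 n]
      have e : (a n : ℂ) = (b + (n : ℂ) ^ 2) * (1 - a n) := by exact_mod_cast h n
      linear_combination coeff f n * e + ((n : ℂ) ^ 2 * (1 - a n) * coeff f n) * Complex.I_sq

theorem ShearSystem.star_smul {E : Type*} [NormedAddCommGroup E] [InnerProductSpace ℝ E]
    (M : ShearSystem E) (r : ℝ) (x : E) : M.star (r • x) = |r| * M.star x := by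
  rw [star, star, map_smul, real_inner_smul_left, real_inner_smul_right, ← mul_assoc, ← sq,
    Real.sqrt_mul (sq_nonneg r), Real.sqrt_sq_eq_abs]

theorem exists_isDeriv (f : H2) : ∃ f' : L2, IsDeriv f f' ∧ IsDeriv f' (secondDeriv f) := by
  have hf := (memlp_coeff (secondDeriv f)).summable (by norm_num)
  have hm : Memℓp (fun n : ℤ => Complex.I * n * coeff (f : L2) n) 2 := by
    refine memℓp_gen (hf.of_nonneg_of_le (fun n => by positivity) fun n => ?_)
    refine Real.rpow_le_rpow (norm_nonneg (Complex.I * (n : ℂ) * coeff (f : L2) n)) ?_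
      (by norm_num)
    rw [coeff_secondDeriv, norm_mul _ (coeff _ _), norm_mul _ (coeff _ _)]
    refine mul_le_mul_of_nonneg_right ?_ (norm_nonneg _)
    rw [norm_pow]
    rcases eq_or_ne n 0 with h | h
    · simp [h]
    · refine le_self_pow₀ ?_ two_ne_zero
      rw [norm_mul, Complex.norm_I, one_mul, Complex.norm_intCast]
      exact_mod_cast Int.one_le_abs h
  refine ⟨ofCoeff _ hm, fun n => coeff_ofCoeff _ hm n, fun n => ?_⟩
  rw [coeff_secondDeriv, coeff_ofCoeff]
  ring

/-! ### Passage to the infimum and rescaling -/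

theorem le_Psi {N : L2 → ℝ} {A : L2 →ₗ.[ℂ] L2} {B : ℝ} (hne : ∃ f : A.domain, N f = 1)
    (h : ∀ (f : A.domain) (μ : ℝ), N f = 1 → B ≤ N (A f - (Complex.I * (μ : ℂ)) • (f : L2))) :
    B ≤ Psi N A := by
  obtain ⟨f, hf⟩ := hne
  refine le_csInf ⟨_, f, 0, hf, rfl⟩ ?_
  rintro _ ⟨f, μ, hf, rfl⟩
  exact h f μ hf

theorem Psi_nonneg {N : L2 → ℝ} (hN : ∀ f, 0 ≤ N f) (A : L2 →ₗ.[ℂ] L2) : 0 ≤ Psi N A := by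
  refine Real.sInf_nonneg ?_
  rintro _ ⟨f, μ, -, rfl⟩
  exact hN _

theorem coeff_fourierBasis (n : ℤ) :
    coeff (fourierBasis 0 : L2) n = if n = 0 then 1 else 0 := by
  rw [coeff_eq_repr, HilbertBasis.repr_self, lp.single_apply, Pi.single_apply]

theorem fourierBasis_zero_mem_H2 : (fourierBasis 0 : L2) ∈ H2 := by
  change Memℓp (fun n : ℤ => (Complex.I * n) ^ 2 * coeff (fourierBasis 0 : L2) n) 2
  convert (zero_memℓp : Memℓp (0 : ℤ → ℂ) 2) using 1
  funext n
  rw [coeff_fourierBasis]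
  split_ifs with h <;> simp [h]

section

variable (A : L2 →ₗ[ℂ] L2) (a : ℤ → ℝ) (δ : ℝ)
  (hA : ∀ f n, coeff (A f) n = a n * coeff f n) (hδ : 0 < δ) (hδa : ∀ n, δ ≤ a n)
  (ha1 : ∀ n, a n ≤ 1) (ha2 : ∀ n, n ≠ 0 → 1 / 2 ≤ a n)
  (hs : (∀ n, a n = 1) ∨ ∃ b : ℝ, 0 ≤ b ∧ ∀ n : ℤ, a n = (b + (n : ℝ) ^ 2) * (1 - a n))

/-- The infimum must run over a nonempty set, as `sInf ∅ = 0` in ℝ; a normalised constant function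
serves. -/
theorem exists_star_eq_one :
    ∃ f : H2, (shearSystem A a δ hA hδ hδa ha1 ha2 hs).star (f : L2) = 1 := by
  set M := shearSystem A a δ hA hδ hδa ha1 ha2 hs
  have h1 : 0 < M.star (fourierBasis 0 : L2) := by
    have h2 : δ * ‖coeff (fourierBasis 0 : L2) 0‖ ^ 2
      ≤ ⟪(fourierBasis 0 : L2), M.A (fourierBasis 0 : L2)⟫_ℝ := M.z_le _
    rw [coeff_fourierBasis, if_pos rfl, norm_one, one_pow, mul_one] at h2
    exact Real.sqrt_pos.2 (hδ.trans_le h2)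
  refine ⟨⟨(M.star (fourierBasis 0 : L2))⁻¹ • (fourierBasis 0 : L2), ?_⟩, ?_⟩
  · exact (H2.restrictScalars ℝ).smul_mem _ fourierBasis_zero_mem_H2
  · rw [M.star_smul, abs_of_pos (inv_pos.2 h1), inv_mul_cancel₀ h1.ne']

/-- T - iμ is ν k_f² times the model operator with l = μ/(ν k_f² α), and ν k_f² √|α| = √|k₁γ|. -/
theorem mul_sqrt_le_Psi {N : L2 → ℝ}
    (hN : ∀ f, N f = (shearSystem A a δ hA hδ hδa ha1 ha2 hs).star f) {ν γ kf : ℝ} {k₁ : ℤ}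
    (hν : 0 < ν) (hkf : 0 < kf) (hγ : kf ^ 4 * ν ^ 2 ≤ |γ|) (T : H2 →ₗ[ℂ] L2)
    (hT : ∀ f : H2, T f = (-((ν : ℂ) * (kf : ℂ) ^ 2)) • secondDeriv f
      + (Complex.I * (k₁ : ℂ) / (kf : ℂ) ^ 2 * ((γ : ℂ) / (ν : ℂ))) • sinMul (A f)) :
    1 / 10 ^ 16 * √|(k₁ : ℝ) * γ| * δ ≤ Psi N ⟨H2, T⟩ := by
  obtain rfl : N = (shearSystem A a δ hA hδ hδa ha1 ha2 hs).star := funext hN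
  set M := shearSystem A a δ hA hδ hδa ha1 ha2 hs with hM
  rcases eq_or_ne k₁ 0 with rfl | hk
  -- For k₁ = 0 the claimed bound is 0.
  · simpa using Psi_nonneg M.star_nonneg _
  refine le_Psi (exists_star_eq_one A a δ hA hδ hδa ha1 ha2 hs) fun f μ hf => ?_
  obtain ⟨f', h, h'⟩ := exists_isDeriv f
  obtain ⟨α, hα⟩ : ∃ α : ℝ, α = k₁ * γ / (kf ^ 4 * ν ^ 2) := ⟨_, rfl⟩
  have hpos : 0 < kf ^ 4 * ν ^ 2 := by positivity
  have hk1 : (1 : ℝ) ≤ |(k₁ : ℝ)| := by exact_mod_cast Int.one_le_abs hk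
  have hα1 : 1 ≤ |α| := by
    rw [hα, abs_div, abs_of_pos hpos, le_div_iff₀ hpos, one_mul, abs_mul]
    exact hγ.trans (le_mul_of_one_le_left (abs_nonneg _) hk1)
  have hα0 : α ≠ 0 := by
    rintro rfl
    norm_num at hα1
  have hkf0 := hkf.ne'
  have hν0 := hν.ne'
  obtain ⟨l, hl⟩ : ∃ l : ℝ, ν * kf ^ 2 * α * l = μ :=
    ⟨μ / (ν * kf ^ 2 * α), by field_simp⟩
  have hop : T f - (Complex.I * (μ : ℂ)) • (f : L2)
      = (ν * kf ^ 2) • M.op α l f (secondDeriv f) := by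
    have e : M.op α l f (secondDeriv f)
        = -secondDeriv f + α • (Complex.I • (sinMul (A f) - l • (f : L2))) := rfl
    have e2 : (ν : ℂ) * kf ^ 2 * α = k₁ / kf ^ 2 * (γ / ν) := by
      have h1 : (kf : ℂ) ≠ 0 := by exact_mod_cast hkf0
      have h2 : (ν : ℂ) ≠ 0 := by exact_mod_cast hν0
      rw [hα]
      push_cast
      field_simp
    have e3 : (ν : ℂ) * kf ^ 2 * α * l = μ := by exact_mod_cast hl
    rw [e, hT]
    refine coeff_injective fun n => ?_
    simp only [coeff_add, coeff_sub, coeff_smul, coeff_real_smul, coeff_neg]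
    push_cast
    linear_combination -(Complex.I * coeff (sinMul (A f)) n) * e2
      + Complex.I * coeff (f : L2) n * e3
  have hmain := M.mul_sqrt_le_star_op α l hα1 h h' hf
  have hsq : √|(k₁ : ℝ) * γ| = ν * kf ^ 2 * √|α| := by
    have : |(k₁ : ℝ) * γ| = (ν * kf ^ 2) ^ 2 * |α| := by
      rw [hα, abs_div, abs_of_pos hpos]
      field_simp
    rw [this, Real.sqrt_mul (sq_nonneg _), Real.sqrt_sq (by positivity)]
  change _ ≤ M.star (T f - (Complex.I * (μ : ℂ)) • (f : L2))
  have hc : 0 < ν * kf ^ 2 := by positivity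
  rw [hop, M.star_smul, abs_of_pos hc, hsq]
  have h2 := mul_le_mul_of_nonneg_left hmain hc.le
  have e : M.δ = δ := rfl
  rw [e] at h2
  linarith

end

theorem coeff_sub_resolvent (β : ℝ) (f : L2) (n : ℤ) :
    coeff ((LinearMap.id - resolvent β : L2 →ₗ[ℂ] L2) f) n
      = ((1 - (β ^ 2 + (n : ℝ) ^ 2)⁻¹ : ℝ) : ℂ) * coeff f n := by
  rw [LinearMap.sub_apply, LinearMap.id_apply, coeff_sub, coeff_resolvent]
  push_cast
  ring

end Kolmogorov

theorem lemma4p2 :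
    ∃ c : ℝ, 0 < c ∧ ∀ K : ℝ, 0 < K → ∃ C : ℝ, 0 < C ∧
      ∀ (kf ν γ : ℝ) (k₁ k₃ : ℤ), 0 < kf → kf ≤ K → 0 < ν → C * ν ^ 2 ≤ |γ| →
        c * √|(k₁ : ℝ) * γ| ≤
            Kolmogorov.Psi (fun f => ‖f‖) (Kolmogorov.opH ν γ kf k₁ k₃) ∧
        (1 < Kolmogorov.beta kf k₁ k₃ ^ 2 →
          c * √|(k₁ : ℝ) * γ| * (1 - (Kolmogorov.beta kf k₁ k₃ ^ 2)⁻¹) ≤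
            Kolmogorov.Psi (Kolmogorov.starNorm (Kolmogorov.beta kf k₁ k₃))
              (Kolmogorov.opL ν γ kf k₁ k₃)) := by
  -- C = K⁴ ensures k_f⁴ν² ≤ |γ|.
  refine ⟨1 / 10 ^ 16, by norm_num, fun K hK => ⟨K ^ 4, by positivity, ?_⟩⟩
  intro kf ν γ k₁ k₃ hkf hkK hν hγ
  have hγ' : kf ^ 4 * ν ^ 2 ≤ |γ| := le_trans (by gcongr) hγ
  constructor
  · have h := Kolmogorov.mul_sqrt_le_Psi (N := fun f => ‖f‖) (k₁ := k₁) LinearMap.id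
      (fun _ => 1) 1 (fun f n => by simp) one_pos (fun _ => le_rfl) (fun _ => le_rfl)
      (fun _ _ => by norm_num) (Or.inl fun _ => rfl) (fun f => ?_) hν hkf hγ'
      (Kolmogorov.opH ν γ kf k₁ k₃).toFun (fun f => rfl)
    · rw [mul_one] at h
      exact h
    · exact ((congrArg Real.sqrt (real_inner_self_eq_norm_sq f)).trans
        (Real.sqrt_sq (norm_nonneg f))).symm
  · intro hβ
    set β := Kolmogorov.beta kf k₁ k₃
    have hpos : ∀ n : ℤ, 1 < β ^ 2 + (n : ℝ) ^ 2 := fun n =>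
      lt_add_of_lt_of_nonneg hβ (sq_nonneg _)
    refine Kolmogorov.mul_sqrt_le_Psi (N := Kolmogorov.starNorm β) (k₁ := k₁)
      (LinearMap.id - Kolmogorov.resolvent β)
      (fun n => 1 - (β ^ 2 + (n : ℝ) ^ 2)⁻¹) (1 - (β ^ 2)⁻¹) (Kolmogorov.coeff_sub_resolvent β)
      (sub_pos.2 (inv_lt_one_of_one_lt₀ hβ)) (fun n => ?_) (fun n => ?_) (fun n hn => ?_)
      -- With b = β² - 1 the symbol is a = (b + n²)/(β² + n²) and 1 - a = 1/(β² + n²); β > 1 makes b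
      -- nonnegative.
      (Or.inr ⟨β ^ 2 - 1, by linarith, fun n => ?_⟩) (fun f => ?_) hν hkf hγ'
      (Kolmogorov.opL ν γ kf k₁ k₃).toFun (fun f => rfl)
    · have : 0 < β ^ 2 := by linarith
      gcongr
      exact le_add_of_nonneg_right (sq_nonneg _)
    · exact sub_le_self _ (inv_nonneg.2 (by linarith [hpos n]))
    · have h1 : (1 : ℝ) ≤ (n : ℝ) ^ 2 := by
        have : (1 : ℤ) ≤ n ^ 2 := Int.one_le_abs hn |> fun h => by
          rw [← sq_abs]; exact one_le_pow₀ h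
        exact_mod_cast this
      have h2 : (β ^ 2 + (n : ℝ) ^ 2)⁻¹ ≤ 2⁻¹ := by
        gcongr
        linarith
      linarith
    · have := (hpos n).trans' one_pos
      field_simp
      ring
    · rw [Kolmogorov.starNorm, ← Kolmogorov.real_inner_eq_re]
      rfl
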